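/- **Setting.** Let $\mathcal X$ be a measurable space, $t,m\ge 1$ integers, $M_0>0$, $\delta\in(0,1)$, and let $\mathcal P_1,\mathcal P_2,\dots$ be probability distributions on $\mathcal X\times\mathbb R$. In each period $j$ one observes $B_j\ge 1$ samples $z_{j,1},\dots,z_{j,B_j}$ from $\mathcal P_j$, all samples being independent. Assume that for all $j$: (i) $|y|\le M_0$ for $\mathcal P_j$-almost every $(x,y)$; (ii) all the $\mathcal P_j$ have the same marginal distribution $\mathcal P$ on $\mathcal X$. Let $f_1,\dots,f_m:\mathcal X\to[-M_0,M_0]$ be measurable models, with loss $\ell(f,(x,y))=(f(x)-y)^2$. Put $f_j^*(x)=\mathbb E_{\mathcal P_j}(y\mid x)$, $\|h\|_{\mathcal P}=\big(\mathbb E_{x\sim\mathcal P}\,h(x)^2\big)^{1/2}$ and $B_{t,k}=\sum_{j=t-k+1}^t B_j$. **Comparison of two models $f',f''$** (hyperparameters $\delta',M$). Let $u_{j,i}=\ell(f',z_{j,i})-\ell(f'',z_{j,i})$. For $k=1,\dots,t$ let $\widehat\mu_{t,k}=B_{t,k}^{-1}\sum_{j=t-k+1}^t\sum_{i=1}^{B_j}u_{j,i}$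 and $\widehat v_{t,k}^2=(B_{t,k}-1)^{-1}\sum_{j=t-k+1}^t\sum_{i=1}^{B_j}(u_{j,i}-\widehat\mu_{t,k})^2$. Let $\widehat\psi(k)=M$ if $B_{t,k}=1$, and otherwise $$\widehat\psi(k)=\widehat v_{t,k}\sqrt{\frac{2\log(2/\delta')}{B_{t,k}}}+\frac{8M\log(2/\delta')}{3(B_{t,k}-1)};\qquad \widehat\phi(k)=\max_{1\le i\le k}\Big(|\widehat\mu_{t,k}-\widehat\mu_{t,i}|-\widehat\psi(k)-\widehat\psi(i)\Big)_+ .$$ Choose any $\widehat k\in\operatorname{argmin}_{1\le k\le t}\{\widehat\phi(k)+\widehat\psi(k)\}$; return $f'$ if $\widehat\mu_{t,\widehat k}\le 0$ and $f''$ otherwise. **Tournament.** Start with all $m$ models. In each of $\lceil\log_2 m\rceil$ rounds, split the remaining models into pairs in an arbitrary way (at most one model stays unpaired and advances), compare the two models of each pair, and keep the winners. Output the single remaining model $\widehat f$. **Theorem (Oracle inequality).** Run the tournament with $\delta'=\delta/(3m^2t)$ and $M=8M_0^2$ (the length of the interval $[-4M_0^2,4M_0^2]$ that contains all loss differences). There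 are a universal exponent $p\in\mathbb N$ and a constant $C>0$ depending only on $M_0$ such that, with probability at least $1-\delta$, the tournament has an output, and every possible output $\widehat f$ (for all choices of $\widehat k$ and of the pairs) satisfies $$\|\widehat f-f_t^*\|_{\mathcal P}-\min_{1\le r\le m}\|f_r-f_t^*\|_{\mathcal P}\le C\,\Lambda^p\min_{1\le k\le t}\Big\{\max_{t-k+1\le j\le t}\|f_j^*-f_t^*\|_{\mathcal P}+\frac1{\sqrt{B_{t,k}}}\Big\},$$ where $\Lambda=(1+\log m)(1+\log t)(1+\log(1/\delta))$. -/

import Mathlib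

open MeasureTheory ProbabilityTheory

noncomputable section

namespace RollingWindow

/-- The periods `t-k+1, …, t` (for `1 ≤ k ≤ t`). -/
def window (t k : ℕ) : Finset ℕ := Finset.Icc (t - k + 1) t

/-- `B_{t,k}`, the number of samples in the `k` most recent periods. -/
def winSize (B : ℕ → ℕ) (t k : ℕ) : ℕ := ∑ j ∈ window t k, B j

/-! ### Adaptive rolling window for mean estimation -/

section Mean

variable {B : ℕ → ℕ}

/-- The rolling-window sample mean. -/
def winMean (u : (j : ℕ) → Fin (B j) → ℝ) (t k : ℕ) : ℝ :=
  (winSize B t k : ℝ)⁻¹ * ∑ j ∈ window t k, ∑ i : Fin (B j), u j i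

/-- The rolling-window sample variance. -/
def winVar (u : (j : ℕ) → Fin (B j) → ℝ) (t k : ℕ) : ℝ :=
  ((winSize B t k : ℝ) - 1)⁻¹ *
    ∑ j ∈ window t k, ∑ i : Fin (B j), (u j i - winMean u t k) ^ 2

/-- The proxy `ψ̂(t, k, δ')` for the stochastic error, with hyperparameter `M`. -/
def psiHat (u : (j : ℕ) → Fin (B j) → ℝ) (M δ' : ℝ) (t k : ℕ) : ℝ :=
  if winSize B t k = 1 then M
  else
    Real.sqrt (winVar u t k) * Real.sqrt (2 * Real.log (2 / δ') / winSize B t k)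
      + 8 * M * Real.log (2 / δ') / (3 * ((winSize B t k : ℝ) - 1))

/-- The proxy `φ̂(t, k, δ')` for the bias: a maximum over the windows `i = 1, …, k`. -/
def phiHat (u : (j : ℕ) → Fin (B j) → ℝ) (M δ' : ℝ) (t k : ℕ) : ℝ :=
  ⨆ i : Finset.Icc 1 k,
    max (|winMean u t k - winMean u t i| - (psiHat u M δ' t k + psiHat u M δ' t i)) 0

/-- `k` is a minimizer of `φ̂ + ψ̂` over the windows `1, …, t`. -/
def IsSelectedWindow (u : (j : ℕ) → Fin (B j) → ℝ) (M δ' : ℝ) (t k : ℕ) : Prop :=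
  k ∈ Finset.Icc 1 t ∧ ∀ k' ∈ Finset.Icc 1 t,
    phiHat u M δ' t k + psiHat u M δ' t k ≤ phiHat u M δ' t k' + psiHat u M δ' t k'

end Mean

/-! ### Pairwise comparison and single-elimination tournament -/

section Selection

variable {X : Type*} {B : ℕ → ℕ} {m : ℕ}

/-- The square loss. -/
def sqLoss (f : X → ℝ) (z : X × ℝ) : ℝ := (f z.1 - z.2) ^ 2

/-- The differences of the losses of two models on the data. -/
def lossDiff (data : (j : ℕ) → Fin (B j) → X × ℝ) (f₁ f₂ : X → ℝ) :
    (j : ℕ) → Fin (B j) → ℝ :=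
  fun j i => sqLoss f₁ (data j i) - sqLoss f₂ (data j i)

/-- `c` is a possible result of comparing model `a` (first) with model `b` (second): some
minimizing window `k` is chosen, and `a` wins if and only if the estimated gap is `≤ 0`. -/
def IsComparisonOutput (data : (j : ℕ) → Fin (B j) → X × ℝ) (M δ' : ℝ) (t : ℕ)
    (f : Fin m → X → ℝ) (a b c : Fin m) : Prop :=
  ∃ k, IsSelectedWindow (lossDiff data (f a) (f b)) M δ' t k ∧
    c = if winMean (lossDiff data (f a) (f b)) t k ≤ 0 then a else b

/-- One round of pairwise comparisons: `IsRound cmp l l'` says that, pairing consecutive members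
of `l`, the winners (and the unpaired last member, if the length is odd) form `l'`. -/
inductive IsRound {ι : Type*} (cmp : ι → ι → ι → Prop) : List ι → List ι → Prop
  | nil : IsRound cmp [] []
  | bye (a : ι) : IsRound cmp [a] [a]
  | pair {a b c : ι} {l l' : List ι} :
      cmp a b c → IsRound cmp l l' → IsRound cmp (a :: b :: l) (c :: l')

/-- `n` successive rounds. Before each round the remaining models are put in an arbitrary order,
so every splitting into pairs is allowed. -/
inductive IsRounds {ι : Type*} (cmp : ι → ι → ι → Prop) : ℕ → List ι → List ι → Prop
  | zero (l : List ι) : IsRounds cmp 0 l l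
  | succ {n : ℕ} {l l₁ l₂ l₃ : List ι} :
      l.Perm l₁ → IsRound cmp l₁ l₂ → IsRounds cmp n l₂ l₃ → IsRounds cmp (n + 1) l l₃

/-- `r` is a possible output of the single-elimination tournament over the models
`f 0, …, f (m-1)`, with `⌈log₂ m⌉` rounds. -/
def IsTournamentOutput (data : (j : ℕ) → Fin (B j) → X × ℝ) (M δ' : ℝ) (t : ℕ)
    (f : Fin m → X → ℝ) (r : Fin m) : Prop :=
  IsRounds (IsComparisonOutput data M δ' t f) (Nat.clog 2 m) (List.finRange m) [r]

end Selection

/-! ### Regression functions and the error norm -/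

section Regression

variable {X : Type*} [MeasurableSpace X]

/-- The regression function `x ↦ E(y | x)` of a distribution of `(x, y)`. -/
def regFun (P : Measure (X × ℝ)) [IsFiniteMeasure P] (x : X) : ℝ :=
  ∫ y, y ∂(P.condKernel x)

/-- The norm `‖h‖_P`. -/
def l2norm (PX : Measure X) (h : X → ℝ) : ℝ := Real.sqrt (∫ x, h x * h x ∂PX)

end Regression

end RollingWindow

end

/-! Write `v r` for the error `‖f_r - f_t^*‖`, `d` for `‖f_a - f_b‖`, and `L = log (2/δ')`. The loss
difference of two models factors as `(f_a - f_b)(f_a + f_b - 2y)`, so its second moment is at most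
`16 M₀² d²`. Since the covariate marginal is common, its mean in period `j` differs from the one in
period `t` by at most `2 d ‖f_j^* - f_t^*‖`. Both error sources thus scale with `d`, and `d ≤ 2 (v a
+ v b)`.

Consequently the estimated risk gap `v a ^ 2 - v b ^ 2` has error at most a constant times `(v a + v
b) ε + ε²`, where `ε` is the drift over the window plus `√(L / B_{t,k})`. A difference of squares
known to this localised accuracy gives `v winner ≤ v loser + O(ε)`, at the fast rate
(`le_add_of_sq_sub_sq_le`). These losses add up over the `⌈log₂ m⌉` rounds (`IsRounds.exists_le`).

The window is chosen by a Lepski-type rule, which attains the best trade-off once `ψ̂` dominates the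
stochastic error in every window (`IsSelectedWindow.abs_winMean_sub_le`). This domination is an
empirical Bernstein inequality for independent, not identically distributed variables
(`empirical_bernstein`). Its delicate part is the lower tail of the sample variance, obtained by
splitting all pairs of indices into classes of disjoint pairs. In the other direction, `ψ̂` is
bounded through the empirical second moment, which rarely exceeds twice its mean by much
(`measureReal_two_mul_integral_le`). A union bound over pairs of models and windows concludes. -/

namespace RollingWindow

/-! ### Elementary bounds for the exponential -/

section ExpBounds

theorem exp_neg_le_quadratic {x : ℝ} (hx : 0 ≤ x) : Real.exp (-x) ≤ 1 - x + x ^ 2 / 2 := by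
  have h1 := Real.quadratic_le_exp_of_nonneg hx
  rw [Real.exp_neg]
  have h2 : (0 : ℝ) < 1 + x + x ^ 2 / 2 := by positivity
  calc (Real.exp x)⁻¹ ≤ (1 + x + x ^ 2 / 2)⁻¹ := inv_anti₀ h2 h1
    _ ≤ 1 - x + x ^ 2 / 2 := by
      rw [inv_le_iff_one_le_mul₀ h2]
      -- The product `(1 + x + x²/2)(1 - x + x²/2)` equals `1 + x⁴/4`.
      nlinarith [sq_nonneg (x ^ 2)]

theorem two_mul_three_pow_le_factorial (n : ℕ) : 2 * 3 ^ n ≤ (n + 2).factorial := by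
  induction n with
  | zero => simp
  | succ n ih =>
    rw [show n + 1 + 2 = (n + 2) + 1 by ring, Nat.factorial_succ, pow_succ]
    nlinarith

/-- Since `(n+2)! ≥ 2 · 3^n`, the Taylor series from degree two on is dominated by `x²/2` times a
geometric series of ratio `b/3`. -/
theorem exp_le_bernstein {x b : ℝ} (hx : |x| ≤ b) (hb : b < 3) :
    Real.exp x ≤ 1 + x + x ^ 2 / (2 * (1 - b / 3)) := by
  have hb0 : 0 ≤ b := (abs_nonneg x).trans hx
  have h1 : HasSum (fun n : ℕ => x ^ n / n.factorial) (Real.exp x) := by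
    rw [Real.exp_eq_exp_ℝ]
    exact NormedSpace.expSeries_div_hasSum_exp x
  have h2 := (hasSum_nat_add_iff' 2).2 h1
  have h3 : HasSum (fun n : ℕ => x ^ 2 / 2 * (b / 3) ^ n) (x ^ 2 / 2 * (1 - b / 3)⁻¹) :=
    (hasSum_geometric_of_lt_one (by positivity) (by linarith)).mul_left _
  have h4 := hasSum_le (fun n => ?_) h2 h3
  · simp only [Finset.sum_range_succ, Finset.sum_range_zero, Nat.factorial] at h4
    have : x ^ 2 / (2 * (1 - b / 3)) = x ^ 2 / 2 * (1 - b / 3)⁻¹ := by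
      rw [div_mul_eq_div_div, div_eq_mul_inv]
    rw [this]
    norm_num at h4 ⊢
    linarith
  · have hf : (2 * 3 ^ n : ℝ) ≤ ((n + 2).factorial : ℝ) := by
      exact_mod_cast two_mul_three_pow_le_factorial n
    calc x ^ (n + 2) / ((n + 2).factorial : ℝ) ≤ |x| ^ (n + 2) / ((n + 2).factorial : ℝ) := by
          refine div_le_div_of_nonneg_right ?_ (by positivity)
          rw [← abs_pow]
          exact le_abs_self _
      _ ≤ |x| ^ (n + 2) / (2 * 3 ^ n) := by gcongr
      _ = x ^ 2 / 2 * (|x| / 3) ^ n := by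
          rw [pow_add, sq_abs, div_pow]; field_simp
      _ ≤ x ^ 2 / 2 * (b / 3) ^ n := by gcongr

end ExpBounds

/-! ### Chernoff's method and exponential moments of bounded variables -/

section Concentration

variable {Ω : Type*} [MeasurableSpace Ω] {μ : Measure Ω}

theorem integral_exp_sum_le {ι : Type*} [Fintype ι] {Y : ι → Ω → ℝ} (hY : iIndepFun Y μ)
    (hm : ∀ i, Measurable (Y i)) {c : ι → ℝ}
    (hc : ∀ i, ∫ ω, Real.exp (Y i ω) ∂μ ≤ Real.exp (c i)) :
    ∫ ω, Real.exp (∑ i, Y i ω) ∂μ ≤ Real.exp (∑ i, c i) := by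
  have h := hY.mgf_sum (t := 1) hm Finset.univ
  simp only [mgf, one_mul, Finset.sum_apply] at h
  rw [h, Real.exp_sum]
  exact Finset.prod_le_prod (fun i _ => integral_nonneg fun ω => (Real.exp_pos _).le)
    fun i _ => hc i

variable [IsProbabilityMeasure μ]

theorem integrable_of_ae_abs_le {Y : Ω → ℝ} (hm : AEStronglyMeasurable Y μ) {b : ℝ}
    (hb : ∀ᵐ ω ∂μ, |Y ω| ≤ b) : Integrable Y μ :=
  Integrable.of_bound hm b hb

theorem integrable_exp_of_ae_abs_le {Y : Ω → ℝ} (hm : Measurable Y) {b : ℝ}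
    (hb : ∀ᵐ ω ∂μ, |Y ω| ≤ b) : Integrable (fun ω => Real.exp (Y ω)) μ := by
  refine Integrable.of_bound (by fun_prop) (Real.exp b) ?_
  filter_upwards [hb] with ω h
  rw [Real.norm_eq_abs, Real.abs_exp]
  exact Real.exp_le_exp.2 ((le_abs_self _).trans h)

theorem measureReal_ge_le_exp_neg {Z : Ω → ℝ} (hi : Integrable (fun ω => Real.exp (Z ω)) μ)
    {c : ℝ} (hc : ∫ ω, Real.exp (Z ω) ∂μ ≤ Real.exp c) (L : ℝ) :
    μ.real {ω | c + L ≤ Z ω} ≤ Real.exp (-L) := by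
  have h := measure_ge_le_exp_mul_mgf (μ := μ) (X := Z) (t := 1) (c + L) zero_le_one
    (by simpa using hi)
  refine h.trans ?_
  simp only [mgf, one_mul]
  calc Real.exp (-1 * (c + L)) * ∫ ω, Real.exp (Z ω) ∂μ
      ≤ Real.exp (-1 * (c + L)) * Real.exp c := by gcongr
    _ = Real.exp (-L) := by rw [← Real.exp_add]; congr 1; ring

theorem measureReal_sum_ge_le_exp_neg {ι : Type*} [Fintype ι] {Y : ι → Ω → ℝ}
    (hY : iIndepFun Y μ) (hm : ∀ i, Measurable (Y i)) {b : ℝ}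
    (hb : ∀ i, ∀ᵐ ω ∂μ, |Y i ω| ≤ b) {c : ι → ℝ}
    (hc : ∀ i, ∫ ω, Real.exp (Y i ω) ∂μ ≤ Real.exp (c i)) (L : ℝ) :
    μ.real {ω | ∑ i, c i + L ≤ ∑ i, Y i ω} ≤ Real.exp (-L) := by
  refine measureReal_ge_le_exp_neg ?_ (integral_exp_sum_le hY hm hc) L
  refine integrable_exp_of_ae_abs_le (Y := fun ω => ∑ i, Y i ω)
    (b := ∑ _i : ι, b) (by fun_prop) ?_
  filter_upwards [ae_all_iff.2 hb] with ω h
  exact (Finset.abs_sum_le_sum_abs _ _).trans (Finset.sum_le_sum fun i _ => h i)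

/-- Bernstein's bound for the moment generating function. -/
theorem integral_exp_centered_le {X : Ω → ℝ} (hm : Measurable X) {M l : ℝ}
    (hl : 0 ≤ l) (hlM : l * M < 3) (hb : ∀ᵐ ω ∂μ, |X ω - ∫ ω', X ω' ∂μ| ≤ M) :
    ∫ ω, Real.exp (l * (X ω - ∫ ω', X ω' ∂μ)) ∂μ
      ≤ Real.exp (l ^ 2 / (2 * (1 - l * M / 3)) * ∫ ω, (X ω - ∫ ω', X ω' ∂μ) ^ 2 ∂μ) := by
  set m := ∫ ω', X ω' ∂μ with hmdef
  have hXi : Integrable (fun ω => X ω - m) μ :=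
    integrable_of_ae_abs_le (by fun_prop) hb
  have hX : Integrable X μ := by
    refine (hXi.add (integrable_const m)).congr (ae_of_all _ fun ω => ?_)
    simp
  have hXi2 : Integrable (fun ω => (X ω - m) ^ 2) μ := by
    refine integrable_of_ae_abs_le (b := M ^ 2) (by fun_prop) ?_
    filter_upwards [hb] with ω h
    rw [abs_pow]
    gcongr
  have hE : Integrable (fun ω => Real.exp (l * (X ω - m))) μ := by
    refine integrable_exp_of_ae_abs_le (b := l * M) (by fun_prop) ?_
    filter_upwards [hb] with ω h
    rw [abs_mul, abs_of_nonneg hl]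
    gcongr
  set q := l ^ 2 / (2 * (1 - l * M / 3)) with hq
  calc ∫ ω, Real.exp (l * (X ω - m)) ∂μ
      ≤ ∫ ω, (1 + l * (X ω - m) + q * (X ω - m) ^ 2) ∂μ := by
        refine integral_mono_ae hE
          (((integrable_const _).add (hXi.const_mul l)).add (hXi2.const_mul q)) ?_
        filter_upwards [hb] with ω h
        have := exp_le_bernstein (x := l * (X ω - m)) (b := l * M)
          (by rw [abs_mul, abs_of_nonneg hl]; gcongr) hlM
        refine this.trans (le_of_eq ?_)
        rw [hq]; ring
    _ = 1 + q * ∫ ω, (X ω - m) ^ 2 ∂μ := by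
        rw [integral_add (by fun_prop) (by fun_prop), integral_add (by fun_prop) (by fun_prop),
          integral_const_mul, integral_const_mul, integral_sub hX (integrable_const m)]
        simp [← hmdef]
    _ ≤ Real.exp (q * ∫ ω, (X ω - m) ^ 2 ∂μ) := by
        linarith [Real.add_one_le_exp (q * ∫ ω, (X ω - m) ^ 2 ∂μ)]

/-- On `[0, b]` one has `Y² ≤ b Y`, so the quadratic term of the expansion is absorbed into the
linear one and only the mean remains. -/
theorem integral_exp_neg_le {Y : Ω → ℝ} (hm : Measurable Y) {b θ : ℝ} (hθ : 0 ≤ θ)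
    (h0 : ∀ᵐ ω ∂μ, 0 ≤ Y ω) (hb : ∀ᵐ ω ∂μ, Y ω ≤ b) :
    ∫ ω, Real.exp (-(θ * Y ω)) ∂μ
      ≤ Real.exp (-((θ - θ ^ 2 * b / 2) * ∫ ω, Y ω ∂μ)) := by
  have habs : ∀ᵐ ω ∂μ, |Y ω| ≤ b := by
    filter_upwards [h0, hb] with ω h1 h2
    rwa [abs_of_nonneg h1]
  have hY : Integrable Y μ := integrable_of_ae_abs_le (by fun_prop) habs
  have hE : Integrable (fun ω => Real.exp (-(θ * Y ω))) μ := by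
    refine integrable_exp_of_ae_abs_le (b := θ * b) (by fun_prop) ?_
    filter_upwards [habs] with ω h
    rw [abs_neg, abs_mul, abs_of_nonneg hθ]
    gcongr
  calc ∫ ω, Real.exp (-(θ * Y ω)) ∂μ
      ≤ ∫ ω, (1 - (θ - θ ^ 2 * b / 2) * Y ω) ∂μ := by
        refine integral_mono_ae hE ((integrable_const _).sub (hY.const_mul _)) ?_
        filter_upwards [h0, hb] with ω h1 h2
        refine (exp_neg_le_quadratic (mul_nonneg hθ h1)).trans ?_
        have : Y ω * Y ω ≤ b * Y ω := by gcongr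
        nlinarith [mul_le_mul_of_nonneg_left this (sq_nonneg θ)]
    _ = 1 - (θ - θ ^ 2 * b / 2) * ∫ ω, Y ω ∂μ := by
        rw [integral_sub (by fun_prop) (by fun_prop), integral_const_mul]
        simp
    _ ≤ _ := by
        linarith [Real.add_one_le_exp (-((θ - θ ^ 2 * b / 2) * ∫ ω, Y ω ∂μ))]

/-- On `[0, 1]`, `e^u ≤ 1 + u + u² ≤ 1 + 2u`. -/
theorem integral_exp_div_bound_le {Y : Ω → ℝ} (hm : Measurable Y) {b : ℝ} (hb0 : 0 < b)
    (h0 : ∀ᵐ ω ∂μ, 0 ≤ Y ω) (hb : ∀ᵐ ω ∂μ, Y ω ≤ b) :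
    ∫ ω, Real.exp (Y ω / b) ∂μ ≤ Real.exp (2 / b * ∫ ω, Y ω ∂μ) := by
  have habs : ∀ᵐ ω ∂μ, |Y ω| ≤ b := by
    filter_upwards [h0, hb] with ω h1 h2
    rwa [abs_of_nonneg h1]
  have hY : Integrable Y μ := integrable_of_ae_abs_le (by fun_prop) habs
  have hE : Integrable (fun ω => Real.exp (Y ω / b)) μ := by
    refine integrable_exp_of_ae_abs_le (b := b / b) (by fun_prop) ?_
    filter_upwards [habs] with ω h
    rw [abs_div, abs_of_pos hb0]
    gcongr
  calc ∫ ω, Real.exp (Y ω / b) ∂μ ≤ ∫ ω, (1 + 2 / b * Y ω) ∂μ := by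
        refine integral_mono_ae hE ((integrable_const _).add (hY.const_mul _)) ?_
        filter_upwards [h0, hb] with ω h1 h2
        have h3 : 0 ≤ Y ω / b := by positivity
        have h4 : Y ω / b ≤ 1 := (div_le_one hb0).2 h2
        have h5 := (abs_le.1 (Real.abs_exp_sub_one_sub_id_le (x := Y ω / b)
          (by rwa [abs_of_nonneg h3]))).2
        have h6 : 2 / b * Y ω = 2 * (Y ω / b) := by ring
        rw [h6]
        nlinarith
    _ = 1 + 2 / b * ∫ ω, Y ω ∂μ := by
        rw [integral_add (by fun_prop) (by fun_prop), integral_const_mul]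
        simp
    _ ≤ _ := by
        linarith [Real.add_one_le_exp (2 / b * ∫ ω, Y ω ∂μ)]

end Concentration

/-! ### Exponential moment of the sum of squared pairwise differences -/

section Concentration

variable {Ω : Type*} [MeasurableSpace Ω] {μ : Measure Ω}

/-- Functions of disjoint pairs of independent variables are independent, so the exponential moment
factors over the pairs. -/
theorem integral_exp_sum_pairs_le {ι : Type*} [DecidableEq ι] {X : ι → Ω → ℝ}
    (hX : iIndepFun X μ) (hm : ∀ i, Measurable (X i)) (σ : ι → ι) {φ : ℝ → ℝ → ℝ}
    (hφ : Measurable fun p : ℝ × ℝ => φ p.1 p.2) {c : ι → ℝ} (s : Finset ι)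
    (hs : (s : Set ι).PairwiseDisjoint fun i => ({i, σ i} : Finset ι))
    (hc : ∀ i ∈ s, ∫ ω, Real.exp (φ (X i ω) (X (σ i) ω)) ∂μ ≤ Real.exp (c i)) :
    ∫ ω, Real.exp (∑ i ∈ s, φ (X i ω) (X (σ i) ω)) ∂μ ≤ Real.exp (∑ i ∈ s, c i) := by
  have : IsProbabilityMeasure μ := hX.isProbabilityMeasure
  induction s using Finset.induction_on with
  | empty => simp
  | insert a s ha ih =>
    simp only [Finset.sum_insert ha, Real.exp_add]
    have hdis : Disjoint ({a, σ a} : Finset ι) (s.biUnion fun i => {i, σ i}) := by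
      rw [Finset.disjoint_biUnion_right]
      intro i hi
      exact hs (by simp) (by simp [hi]) (fun h => ha (h ▸ hi))
    have hI := hX.indepFun_finset _ _ hdis hm
    have hI2 : IndepFun (fun ω => Real.exp (φ (X a ω) (X (σ a) ω)))
        (fun ω => Real.exp (∑ i ∈ s, φ (X i ω) (X (σ i) ω))) μ := by
      have hF : Measurable fun x : ({a, σ a} : Finset ι) → ℝ =>
          Real.exp (φ (x ⟨a, by simp⟩) (x ⟨σ a, by simp⟩)) :=
        Real.measurable_exp.comp (hφ.comp
          (Measurable.prodMk (measurable_pi_apply _) (measurable_pi_apply _)))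
      have hG : Measurable fun x : (s.biUnion fun i => ({i, σ i} : Finset ι)) → ℝ =>
          Real.exp (∑ i : s, φ (x ⟨i, Finset.mem_biUnion.2 ⟨i, i.2, by simp⟩⟩)
            (x ⟨σ i, Finset.mem_biUnion.2 ⟨i, i.2, by simp⟩⟩)) := by
        refine Real.measurable_exp.comp (Finset.measurable_sum _ fun i _ => hφ.comp
          (Measurable.prodMk (measurable_pi_apply _) (measurable_pi_apply _)))
      have h := hI.comp hF hG
      have e : (fun ω => Real.exp (∑ i ∈ s, φ (X i ω) (X (σ i) ω))) =
          fun ω => Real.exp (∑ i : s, φ (X i ω) (X (σ i) ω)) := by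
        funext ω
        rw [Finset.sum_coe_sort s fun i => φ (X i ω) (X (σ i) ω)]
      rw [e]
      exact h
    have hmeas : ∀ i, Measurable fun ω => φ (X i ω) (X (σ i) ω) := fun i =>
      hφ.comp ((hm i).prodMk (hm (σ i)))
    rw [hI2.integral_fun_mul_eq_mul_integral
      (Real.measurable_exp.comp (hmeas a)).aestronglyMeasurable
      (Real.measurable_exp.comp
        (Finset.measurable_sum _ fun i _ => hmeas i)).aestronglyMeasurable]
    refine mul_le_mul (hc a (by simp)) (ih (hs.subset (by simp)) fun i hi => hc i (by simp [hi]))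
      (integral_nonneg fun ω => (Real.exp_pos _).le) (Real.exp_pos _).le

/-- The reflection `i ↦ c - i` is an involution: each orbit of size two is counted twice, and fixed
points contribute the diagonal value zero. Comparing `val` selects one representative per orbit. -/
theorem sum_reflect_eq_two_mul {n : ℕ} [NeZero n] (c : ZMod n) {h : ZMod n → ZMod n → ℝ}
    (hsymm : ∀ i j, h i j = h j i) (hdiag : ∀ i, h i i = 0) :
    ∑ i, h i (c - i) = 2 * ∑ i with i.val < (c - i).val, h i (c - i) := by
  have h1 : ∑ i with ¬ (i.val < (c - i).val), h i (c - i)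
      = ∑ i with i.val < (c - i).val, h i (c - i) := by
    have h2 : ∑ i with ¬ (i.val < (c - i).val), h i (c - i)
        = ∑ i with (c - i).val < i.val, h i (c - i) := by
      symm
      refine Finset.sum_subset (fun i => ?_) fun i hi hi' => ?_
      · simp only [Finset.mem_filter, Finset.mem_univ, true_and]; omega
      · simp only [Finset.mem_filter, Finset.mem_univ, true_and] at hi hi'
        have : c - i = i := ZMod.val_injective n (by omega)
        rw [this, hdiag]
    rw [h2]
    refine Finset.sum_nbij' (fun i => c - i) (fun i => c - i) ?_ ?_ ?_ ?_ ?_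
    · intro i; simp
    · intro i; simp
    · intro i; simp
    · intro i; simp
    · intro i _; simp [hsymm i]
  rw [← Finset.sum_filter_add_sum_filter_not Finset.univ fun i => i.val < (c - i).val, h1]
  ring

theorem sum_sum_eq_sum_reflect {n : ℕ} [NeZero n] (h : ZMod n → ZMod n → ℝ) :
    ∑ i, ∑ j, h i j = ∑ c, ∑ i, h i (c - i) := by
  rw [Finset.sum_comm (γ := ZMod n) (f := fun c i => h i (c - i))]
  refine Finset.sum_congr rfl fun i _ => ?_
  exact ((Equiv.subRight i).sum_comp (h i)).symm

theorem pairwiseDisjoint_reflect {n : ℕ} (c : ZMod n) :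
    ({i : ZMod n | i.val < (c - i).val} : Set (ZMod n)).PairwiseDisjoint
      fun i => ({i, c - i} : Finset (ZMod n)) := by
  intro i hi j hj hij
  simp only [Set.mem_ofPred_eq] at hi hj
  rw [Function.onFun, Finset.disjoint_left]
  intro a ha hb
  simp only [Finset.mem_insert, Finset.mem_singleton] at ha hb
  rcases ha with rfl | rfl <;> rcases hb with hb | hb
  · exact hij hb
  · subst hb
    simp only [sub_sub_cancel] at hi
    omega
  · subst hb
    simp only [sub_sub_cancel] at hj
    omega
  · exact hij (by simpa using hb)

variable [IsProbabilityMeasure μ]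

/-- Hoeffding's device for U-statistics. Sorting the pairs `(i, j)` by `c = i + j` in `ZMod n`
writes the normalised double sum as an average over `c` of sums over disjoint pairs. Jensen's
inequality for `exp` then reduces the claim to a single class, whose terms are independent. -/
theorem integral_exp_neg_sum_sq_sub_le_zmod {n : ℕ} [NeZero n] {X : ZMod n → Ω → ℝ}
    (hX : iIndepFun X μ) (hm : ∀ i, Measurable (X i)) {M θ : ℝ} (hθ : 0 ≤ θ)
    (hb : ∀ i j, ∀ᵐ ω ∂μ, |X i ω - X j ω| ≤ M) :
    ∫ ω, Real.exp (-(θ * ((∑ i, ∑ j, (X i ω - X j ω) ^ 2) / (2 * n)))) ∂μ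
      ≤ Real.exp (-((θ - θ ^ 2 * M ^ 2 / 2) *
          ((∑ i, ∑ j, ∫ ω, (X i ω - X j ω) ^ 2 ∂μ) / (2 * n)))) := by
  have hn : (0 : ℝ) < n := by exact_mod_cast Nat.pos_of_ne_zero (NeZero.ne n)
  set κ := θ - θ ^ 2 * M ^ 2 / 2 with hκ
  set R : ZMod n → Finset (ZMod n) := fun c => {i | i.val < (c - i).val} with hR
  have hsq : ∀ i j, ∀ᵐ ω ∂μ, (X i ω - X j ω) ^ 2 ≤ M ^ 2 := fun i j => by
    filter_upwards [hb i j] with ω h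
    exact sq_le_sq' (abs_le.1 h).1 (abs_le.1 h).2
  -- one class of disjoint pairs
  have hclass : ∀ c : ZMod n,
      ∫ ω, Real.exp (∑ i ∈ R c, -(θ * (X i ω - X (c - i) ω) ^ 2)) ∂μ
        ≤ Real.exp (∑ i ∈ R c, -(κ * ∫ ω, (X i ω - X (c - i) ω) ^ 2 ∂μ)) := by
    intro c
    refine integral_exp_sum_pairs_le hX hm (fun i => c - i)
      (φ := fun x y => -(θ * (x - y) ^ 2)) (by fun_prop) (R c) ?_ fun i _ => ?_
    · have := pairwiseDisjoint_reflect c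
      simpa [hR] using this
    · exact integral_exp_neg_le (Y := fun ω => (X i ω - X (c - i) ω) ^ 2) (by fun_prop) hθ
        (ae_of_all _ fun ω => sq_nonneg _) (hsq _ _)
  have hsum : ∀ h : ZMod n → ZMod n → ℝ, (∀ i j, h i j = h j i) → (∀ i, h i i = 0) →
      (∑ i, ∑ j, h i j) / (2 * n) = ∑ c, (n : ℝ)⁻¹ * ∑ i ∈ R c, h i (c - i) := by
    intro h h1 h2
    rw [sum_sum_eq_sum_reflect, Finset.sum_congr rfl fun c _ => sum_reflect_eq_two_mul c h1 h2,
      ← Finset.mul_sum, ← Finset.mul_sum]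
    field_simp
    rfl
  have hint : ∀ c : ZMod n, Integrable (fun ω =>
      Real.exp (∑ i ∈ R c, -(θ * (X i ω - X (c - i) ω) ^ 2)
        + ∑ i ∈ R c, κ * ∫ ω, (X i ω - X (c - i) ω) ^ 2 ∂μ)) μ := by
    intro c
    simp only [Real.exp_add]
    refine Integrable.mul_const ?_ _
    refine Integrable.of_bound (by fun_prop) 1 (ae_of_all _ fun ω => ?_)
    rw [Real.norm_eq_abs, Real.abs_exp, Real.exp_le_one_iff]
    refine Finset.sum_nonpos fun i _ => ?_
    have := mul_nonneg hθ (sq_nonneg (X i ω - X (c - i) ω))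
    linarith
  set W := (∑ i, ∑ j, ∫ ω, (X i ω - X j ω) ^ 2 ∂μ) / (2 * n) with hW
  have hWeq : κ * W = ∑ c, (n : ℝ)⁻¹ * ∑ i ∈ R c, κ * ∫ ω, (X i ω - X (c - i) ω) ^ 2 ∂μ := by
    rw [hW, hsum (fun i j => ∫ ω, (X i ω - X j ω) ^ 2 ∂μ), Finset.mul_sum]
    · refine Finset.sum_congr rfl fun c _ => ?_
      rw [← Finset.mul_sum]; ring
    · intro i j
      refine integral_congr_ae (ae_of_all _ fun ω => ?_)
      simp only; ring
    · simp
  -- Jensen with equal weights `1/n`; adding `κ * W` normalises every class so that its exponential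
  -- moment is at most one.
  have hpt : ∀ ω, Real.exp (-(θ * ((∑ i, ∑ j, (X i ω - X j ω) ^ 2) / (2 * n))) + κ * W)
      ≤ ∑ c : ZMod n, (n : ℝ)⁻¹ * Real.exp (∑ i ∈ R c, -(θ * (X i ω - X (c - i) ω) ^ 2)
        + ∑ i ∈ R c, κ * ∫ ω, (X i ω - X (c - i) ω) ^ 2 ∂μ) := by
    intro ω
    have e : -(θ * ((∑ i, ∑ j, (X i ω - X j ω) ^ 2) / (2 * n))) + κ * W
        = ∑ c : ZMod n, (n : ℝ)⁻¹ • (∑ i ∈ R c, -(θ * (X i ω - X (c - i) ω) ^ 2)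
          + ∑ i ∈ R c, κ * ∫ ω, (X i ω - X (c - i) ω) ^ 2 ∂μ) := by
      rw [hWeq, hsum (fun i j => (X i ω - X j ω) ^ 2) (fun i j => by ring) (by simp),
        Finset.mul_sum, ← Finset.sum_neg_distrib, ← Finset.sum_add_distrib]
      refine Finset.sum_congr rfl fun c _ => ?_
      have hneg : ∑ i ∈ R c, -(θ * (X i ω - X (c - i) ω) ^ 2)
          = -(θ * ∑ i ∈ R c, (X i ω - X (c - i) ω) ^ 2) := by
        rw [Finset.sum_neg_distrib, ← Finset.mul_sum]
      rw [smul_eq_mul, hneg, mul_add]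
      congr 1
      rw [mul_neg, mul_left_comm]
    rw [e]
    have := convexOn_exp.map_sum_le (t := (Finset.univ : Finset (ZMod n)))
      (w := fun _ => (n : ℝ)⁻¹) (p := fun c => ∑ i ∈ R c, -(θ * (X i ω - X (c - i) ω) ^ 2)
        + ∑ i ∈ R c, κ * ∫ ω, (X i ω - X (c - i) ω) ^ 2 ∂μ) (fun _ _ => by positivity)
      (by simp [ZMod.card, hn.ne']) (fun _ _ => Set.mem_univ _)
    simpa only [smul_eq_mul] using this
  have hone : ∫ ω, Real.exp (-(θ * ((∑ i, ∑ j, (X i ω - X j ω) ^ 2) / (2 * n))) + κ * W) ∂μ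
      ≤ 1 := by
    refine (integral_mono_of_nonneg (ae_of_all _ fun ω => (Real.exp_pos _).le)
      (integrable_finsetSum _ fun c _ => (hint c).const_mul _) (ae_of_all _ hpt)).trans ?_
    rw [integral_finsetSum _ fun c _ => (hint c).const_mul _]
    calc ∑ c : ZMod n, ∫ ω, (n : ℝ)⁻¹ * Real.exp (∑ i ∈ R c, -(θ * (X i ω - X (c - i) ω) ^ 2)
        + ∑ i ∈ R c, κ * ∫ ω, (X i ω - X (c - i) ω) ^ 2 ∂μ) ∂μ
        ≤ ∑ c : ZMod n, (n : ℝ)⁻¹ * 1 := by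
          refine Finset.sum_le_sum fun c _ => ?_
          rw [integral_const_mul]
          refine mul_le_mul_of_nonneg_left ?_ (by positivity)
          simp only [Real.exp_add]
          rw [integral_mul_const]
          calc _ ≤ Real.exp (∑ i ∈ R c, -(κ * ∫ ω, (X i ω - X (c - i) ω) ^ 2 ∂μ)) *
              Real.exp (∑ i ∈ R c, κ * ∫ ω, (X i ω - X (c - i) ω) ^ 2 ∂μ) := by
                gcongr
                exact hclass c
            _ = 1 := by
                rw [← Real.exp_add, Finset.sum_neg_distrib]; simp
      _ = 1 := by simp [ZMod.card, hn.ne']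
  simp only [Real.exp_add] at hone
  rw [integral_mul_const] at hone
  rw [Real.exp_neg, ← one_div, le_div_iff₀ (Real.exp_pos _)]
  exact hone

theorem integral_exp_neg_sum_sq_sub_le {ι : Type*} [Fintype ι] [Nonempty ι] {X : ι → Ω → ℝ}
    (hX : iIndepFun X μ) (hm : ∀ i, Measurable (X i)) {M θ : ℝ} (hθ : 0 ≤ θ)
    (hb : ∀ i j, ∀ᵐ ω ∂μ, |X i ω - X j ω| ≤ M) :
    ∫ ω, Real.exp (-(θ * ((∑ i, ∑ j, (X i ω - X j ω) ^ 2) / (2 * Fintype.card ι)))) ∂μ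
      ≤ Real.exp (-((θ - θ ^ 2 * M ^ 2 / 2) *
          ((∑ i, ∑ j, ∫ ω, (X i ω - X j ω) ^ 2 ∂μ) / (2 * Fintype.card ι)))) := by
  have : NeZero (Fintype.card ι) := ⟨Fintype.card_ne_zero⟩
  have e : ZMod (Fintype.card ι) ≃ ι := Fintype.equivOfCardEq (ZMod.card _)
  have h := integral_exp_neg_sum_sq_sub_le_zmod (hX.precomp e.injective) (fun i => hm (e i)) hθ
    (fun i j => hb (e i) (e j))
  have hs : ∀ g : ι → ι → ℝ, ∑ i, ∑ j, g (e i) (e j) = ∑ i, ∑ j, g i j := fun g => by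
    rw [← e.sum_comp]
    exact Finset.sum_congr rfl fun i _ => e.sum_comp _
  rw [hs fun i j => ∫ ω, (X i ω - X j ω) ^ 2 ∂μ] at h
  convert h using 9 with ω
  exact (hs fun i j => (X i ω - X j ω) ^ 2).symm

end Concentration

/-! ### Bernstein's inequality with empirical variance -/

section Concentration

theorem sum_sum_sq_sub_div {ι : Type*} [Fintype ι] [Nonempty ι] (x : ι → ℝ) :
    (∑ i, ∑ j, (x i - x j) ^ 2) / (2 * Fintype.card ι)
      = ∑ i, (x i - (Fintype.card ι : ℝ)⁻¹ * ∑ j, x j) ^ 2 := by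
  have hn : (Fintype.card ι : ℝ) ≠ 0 := by exact_mod_cast Fintype.card_ne_zero
  have e1 : ∑ i, ∑ j, (x i - x j) ^ 2
      = 2 * Fintype.card ι * ∑ i, x i ^ 2 - 2 * (∑ i, x i) * ∑ i, x i := by
    have : ∀ i j, (x i - x j) ^ 2 = x i ^ 2 + x j ^ 2 - 2 * (x i * x j) := fun i j => by ring
    simp only [this, Finset.sum_sub_distrib, Finset.sum_add_distrib, Finset.sum_const,
      Finset.card_univ, nsmul_eq_mul, ← Finset.mul_sum, ← Finset.sum_mul]
    ring
  have e2 : ∀ c : ℝ, ∑ i, (x i - c) ^ 2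
      = ∑ i, x i ^ 2 - 2 * c * ∑ i, x i + Fintype.card ι * c ^ 2 := by
    intro c
    have : ∀ i, (x i - c) ^ 2 = x i ^ 2 - 2 * c * x i + c ^ 2 := fun i => by ring
    simp only [this, Finset.sum_sub_distrib, Finset.sum_add_distrib, Finset.sum_const,
      Finset.card_univ, nsmul_eq_mul, ← Finset.mul_sum]
  rw [e1, e2]
  field_simp
  ring

variable {Ω : Type*} [MeasurableSpace Ω] {μ : Measure Ω} [IsProbabilityMeasure μ]
  {ι : Type*} [Fintype ι]

theorem bernstein_sum {X : ι → Ω → ℝ} (hX : iIndepFun X μ) (hm : ∀ i, Measurable (X i))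
    {M L : ℝ} (hM : 0 < M) (hL : 0 < L) (hb : ∀ i, ∀ᵐ ω ∂μ, |X i ω - ∫ ω', X i ω' ∂μ| ≤ M) :
    μ.real {ω | √(2 * (∑ i, variance (X i) μ) * L) + 2 / 3 * M * L
        ≤ ∑ i, (X i ω - ∫ ω', X i ω' ∂μ)} ≤ Real.exp (-L) := by
  set S := ∑ i, variance (X i) μ with hS
  have hS0 : 0 ≤ S := Finset.sum_nonneg fun i _ => variance_nonneg _ _
  have key : ∀ l : ℝ, 0 ≤ l → l * M < 3 →
      l ^ 2 / (2 * (1 - l * M / 3)) * S + L ≤ l * (√(2 * S * L) + 2 / 3 * M * L) →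
      μ.real {ω | √(2 * S * L) + 2 / 3 * M * L ≤ ∑ i, (X i ω - ∫ ω', X i ω' ∂μ)}
        ≤ Real.exp (-L) := by
    intro l hl hlM hle
    have hY : iIndepFun (fun i ω => l * (X i ω - ∫ ω', X i ω' ∂μ)) μ :=
      hX.comp (fun i x => l * (x - ∫ ω', X i ω' ∂μ)) fun i => by fun_prop
    have h := measureReal_sum_ge_le_exp_neg hY (fun i => by fun_prop) (b := l * M)
      (c := fun i => l ^ 2 / (2 * (1 - l * M / 3)) * variance (X i) μ) (fun i => ?_)
      (fun i => ?_) L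
    · refine (measureReal_mono ?_).trans h
      intro ω hω
      simp only [Set.mem_ofPred_eq] at hω ⊢
      rw [← Finset.mul_sum, ← Finset.mul_sum, ← hS]
      exact hle.trans (mul_le_mul_of_nonneg_left hω hl)
    · filter_upwards [hb i] with ω h
      rw [abs_mul, abs_of_nonneg hl]
      gcongr
    · have := integral_exp_centered_le (hm i) hl hlM (hb i)
      rwa [← variance_eq_integral (hm i).aemeasurable] at this
  -- For `S > 0` the parameter `l = r / (1 + M r / 3)` would give equality with `M L / 3` in the
  -- threshold. The larger `2/3` leaves room for the degenerate case `S = 0`, where `l = 3 / M` is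
  -- not admissible and half of it is used.
  rcases hS0.eq_or_lt with h0 | hpos
  · refine key (3 / (2 * M)) (by positivity) ?_ ?_
    · field_simp; norm_num
    · rw [← h0]
      simp only [mul_zero, zero_mul, Real.sqrt_zero, zero_add]
      apply le_of_eq
      field_simp
  · set r := √(2 * L / S) with hr
    have hr0 : 0 < r := Real.sqrt_pos.2 (by positivity)
    have hr2 : r ^ 2 * S = 2 * L := by
      rw [hr, Real.sq_sqrt (by positivity)]; field_simp
    have hrS : √(2 * S * L) = r * S := by
      rw [Real.sqrt_eq_iff_mul_self_eq (by positivity) (by positivity)]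
      nlinarith
    have hd : 0 < 1 + M * r / 3 := by positivity
    have hMr : 0 < M * r := by positivity
    have hone : 1 - r / (1 + M * r / 3) * M / 3 = 1 / (1 + M * r / 3) := by
      field_simp; ring
    refine key (r / (1 + M * r / 3)) (by positivity) ?_ ?_
    · rw [div_mul_eq_mul_div, div_lt_iff₀ hd]
      nlinarith
    · rw [hone, hrS]
      have e1 : (r / (1 + M * r / 3)) ^ 2 / (2 * (1 / (1 + M * r / 3))) * S
          = L / (1 + M * r / 3) := by
        have : L = r ^ 2 * S / 2 := by linarith
        rw [this]
        field_simp
      have e2 : r / (1 + M * r / 3) * (r * S + 2 / 3 * M * L)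
          = (2 * L + 2 / 3 * (M * r) * L) / (1 + M * r / 3) := by
        rw [← hr2]; field_simp
      rw [e1, e2, ← sub_nonneg]
      have : (2 * L + 2 / 3 * (M * r) * L) / (1 + M * r / 3) - (L / (1 + M * r / 3) + L)
          = (M * r) * L / 3 / (1 + M * r / 3) := by
        field_simp; ring
      rw [this]
      positivity

/-- `E (X - Y)²` is the variance of `X - Y` plus the squared difference of the means. Unequal means
therefore only increase the sample variance in expectation, which is why drift does no harm to the
variance proxy. -/
theorem integral_sq_sub_ge {X Y : Ω → ℝ} (hXY : IndepFun X Y μ) (hX : MemLp X 2 μ)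
    (hY : MemLp Y 2 μ) :
    variance X μ + variance Y μ ≤ ∫ ω, (X ω - Y ω) ^ 2 ∂μ := by
  have h1 := variance_le_expectation_sq (hX.sub hY).aestronglyMeasurable
  rw [variance_sub hX hY, hXY.covariance_eq_zero hX hY] at h1
  simp only [mul_zero, sub_zero] at h1
  exact h1

theorem sum_integral_sq_sub_ge {X : ι → Ω → ℝ} (hX : iIndepFun X μ)
    (hL : ∀ i, MemLp (X i) 2 μ) :
    2 * ((Fintype.card ι : ℝ) - 1) * ∑ i, variance (X i) μ
      ≤ ∑ i, ∑ j, ∫ ω, (X i ω - X j ω) ^ 2 ∂μ := by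
  classical
  calc 2 * ((Fintype.card ι : ℝ) - 1) * ∑ i, variance (X i) μ
      = ∑ i, ∑ j, (variance (X i) μ + variance (X j) μ
          - if i = j then 2 * variance (X i) μ else 0) := by
        simp only [Finset.sum_sub_distrib, Finset.sum_add_distrib, Finset.sum_const,
          Finset.sum_ite_eq, Finset.mem_univ, if_true, Finset.card_univ, nsmul_eq_mul,
          ← Finset.mul_sum]
        ring
    _ ≤ _ := by
        refine Finset.sum_le_sum fun i _ => Finset.sum_le_sum fun j _ => ?_
        split_ifs with h
        · subst h
          have : 0 ≤ ∫ ω, (X i ω - X i ω) ^ 2 ∂μ := integral_nonneg fun ω => sq_nonneg _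
          linarith
        · have := integral_sq_sub_ge (hX.indepFun h) (hL i) (hL j)
          linarith

/-- Lower tail of the empirical variance of independent, not identically distributed variables. -/
theorem measureReal_sum_sq_sub_lt_le [Nonempty ι] {X : ι → Ω → ℝ} (hX : iIndepFun X μ)
    (hm : ∀ i, Measurable (X i)) (h2 : ∀ i, MemLp (X i) 2 μ)
    {M L T : ℝ} (hM : 0 < M) (hL : 0 < L)
    (hb : ∀ i j, ∀ᵐ ω ∂μ, |X i ω - X j ω| ≤ M)
    (hT : T = ((Fintype.card ι : ℝ) - 1) / Fintype.card ι * ∑ i, variance (X i) μ) :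
    μ.real {ω | ∑ i, (X i ω - (Fintype.card ι : ℝ)⁻¹ * ∑ j, X j ω) ^ 2
        < T - M * √(2 * L * T)} ≤ Real.exp (-L) := by
  have hn1 : (1 : ℝ) ≤ Fintype.card ι := by exact_mod_cast Fintype.card_pos (α := ι)
  have hn : (0 : ℝ) < Fintype.card ι := by linarith
  have hT0 : 0 ≤ T := by
    rw [hT]
    exact mul_nonneg (div_nonneg (by linarith) hn.le)
      (Finset.sum_nonneg fun i _ => variance_nonneg _ _)
  set W := (∑ i, ∑ j, ∫ ω, (X i ω - X j ω) ^ 2 ∂μ) / (2 * Fintype.card ι) with hW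
  have hTW : T ≤ W := by
    rw [hT, hW, le_div_iff₀ (by positivity)]
    refine le_trans (le_of_eq ?_) (sum_integral_sq_sub_ge hX h2)
    field_simp
  -- In this range the threshold is nonpositive and the event is empty. Otherwise `θ = r / M` with
  -- `r = √(2L/T)` makes the Chernoff exponent match the threshold exactly, and `r * M ≤ 1` keeps
  -- the coefficient of `W` nonnegative.
  by_cases hcase : T ≤ 2 * L * M ^ 2
  · have hempty : {ω | ∑ i, (X i ω - (Fintype.card ι : ℝ)⁻¹ * ∑ j, X j ω) ^ 2
        < T - M * √(2 * L * T)} = ∅ := by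
      ext ω
      simp only [Set.mem_ofPred_eq, Set.mem_empty_iff_false, iff_false, not_lt]
      have h1 : T ≤ M * √(2 * L * T) := by
        rw [← Real.sqrt_sq hM.le, ← Real.sqrt_mul (sq_nonneg M)]
        apply Real.le_sqrt_of_sq_le
        nlinarith
      have : 0 ≤ ∑ i, (X i ω - (Fintype.card ι : ℝ)⁻¹ * ∑ j, X j ω) ^ 2 :=
        Finset.sum_nonneg fun i _ => sq_nonneg _
      linarith
    rw [hempty]
    simp [(Real.exp_pos _).le]
  · have hTpos : 0 < T := lt_of_le_of_lt (by positivity) (not_le.1 hcase)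
    set r := √(2 * L / T) with hr
    have hr0 : 0 < r := Real.sqrt_pos.2 (by positivity)
    have hr2 : r ^ 2 * T = 2 * L := by
      rw [hr, Real.sq_sqrt (by positivity)]; field_simp
    have hrT : √(2 * L * T) = r * T := by
      rw [Real.sqrt_eq_iff_mul_self_eq (by positivity) (by positivity)]
      nlinarith
    have hrM : r * M ≤ 1 := by
      rw [← abs_of_pos (mul_pos hr0 hM), ← sq_le_one_iff_abs_le_one]
      have : (r * M) ^ 2 * T ≤ 1 * T := by
        have : (r * M) ^ 2 * T = r ^ 2 * T * M ^ 2 := by ring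
        rw [this, hr2]; linarith
      exact le_of_mul_le_mul_right this hTpos
    have h := integral_exp_neg_sum_sq_sub_le hX hm (θ := r / M) (by positivity) hb
    rw [← hW] at h
    have hκ : r / M - (r / M) ^ 2 * M ^ 2 / 2 = r / M - r ^ 2 / 2 := by field_simp
    rw [hκ] at h
    have hmain := measureReal_ge_le_exp_neg (Z := fun ω => -(r / M *
      ((∑ i, ∑ j, (X i ω - X j ω) ^ 2) / (2 * Fintype.card ι)))) ?_ h L
    · refine (measureReal_mono ?_).trans hmain
      intro ω hω
      simp only [Set.mem_ofPred_eq] at hω ⊢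
      rw [sum_sum_sq_sub_div]
      set Q := ∑ i, (X i ω - (Fintype.card ι : ℝ)⁻¹ * ∑ j, X j ω) ^ 2
      rw [hrT] at hω
      have hk : 0 ≤ r / M - r ^ 2 / 2 := by
        have : r / M - r ^ 2 / 2 = r / M * (1 - r * M / 2) := by field_simp
        rw [this]
        refine mul_nonneg (by positivity) (by linarith)
      have h3 : (r / M - r ^ 2 / 2) * T ≤ (r / M - r ^ 2 / 2) * W :=
        mul_le_mul_of_nonneg_left hTW hk
      have h4 : r / M * Q ≤ r / M * (T - M * (r * T)) :=
        mul_le_mul_of_nonneg_left hω.le (by positivity)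
      have h5 : r / M * (T - M * (r * T)) = r / M * T - r ^ 2 * T := by field_simp
      linarith
    · refine Integrable.of_bound (by fun_prop) 1 (ae_of_all _ fun ω => ?_)
      rw [Real.norm_eq_abs, Real.abs_exp, Real.exp_le_one_iff, neg_nonpos]
      exact mul_nonneg (by positivity) (div_nonneg (Finset.sum_nonneg fun i _ =>
        Finset.sum_nonneg fun j _ => sq_nonneg _) (by positivity))

/-- The lower bound on `Q` is a quadratic inequality in `√T`; solving it gives `√T ≤ √Q + M √(2L)`,
which replaces the true variance in Bernstein's bound by the empirical one. The correction costs
`2ML/(n-1)`, and with Bernstein's own `2/3` this produces the constant `8/3`. -/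
theorem empirical_bernstein_deterministic {n S L M Q D : ℝ} (hn : 2 ≤ n) (hS : 0 ≤ S)
    (hL : 0 < L) (hM : 0 < M) (hD : n * D ≤ √(2 * S * L) + 2 / 3 * M * L)
    (hQ0 : 0 ≤ Q)
    (hQ : (n - 1) / n * S - M * √(2 * L * ((n - 1) / n * S)) ≤ Q) :
    D ≤ √((n - 1)⁻¹ * Q) * √(2 * L / n) + 8 * M * L / (3 * (n - 1)) := by
  have hn0 : 0 < n := by linarith
  have hn1 : 0 < n - 1 := by linarith
  set T := (n - 1) / n * S with hT
  have hT0 : 0 ≤ T := by positivity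
  have hsq : √T ≤ √Q + M * √(2 * L) := by
    rw [Real.sqrt_mul (by positivity)] at hQ
    by_contra hcon
    push Not at hcon
    have hx := Real.mul_self_sqrt hT0
    have hq := Real.mul_self_sqrt hQ0
    have h1 : 0 ≤ √Q := Real.sqrt_nonneg _
    have h2 : 0 ≤ M * √(2 * L) := by positivity
    have h3 : 0 ≤ √T := Real.sqrt_nonneg _
    nlinarith
  have e : √(2 * S * L) = n * (√((n - 1)⁻¹) * √T * √(2 * L / n)) := by
    rw [← Real.sqrt_mul (by positivity), ← Real.sqrt_mul (by positivity),
      Real.sqrt_eq_iff_mul_self_eq (by positivity) (by positivity)]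
    have := Real.mul_self_sqrt (show 0 ≤ (n - 1)⁻¹ * T * (2 * L / n) by positivity)
    rw [mul_mul_mul_comm, this, hT]
    field_simp
  rw [e] at hD
  have h1 : D ≤ √((n - 1)⁻¹) * √T * √(2 * L / n) + 2 / 3 * M * L / n := by
    have : n * D ≤ n * (√((n - 1)⁻¹) * √T * √(2 * L / n) + 2 / 3 * M * L / n) := by
      refine hD.trans (le_of_eq ?_)
      field_simp
    exact le_of_mul_le_mul_left this hn0
  have h2 : √((n - 1)⁻¹) * √T * √(2 * L / n)
      ≤ √((n - 1)⁻¹) * (√Q + M * √(2 * L)) * √(2 * L / n) := by gcongr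
  have h3 : √((n - 1)⁻¹) * √(2 * L) * √(2 * L / n) ≤ 2 * L / (n - 1) := by
    calc √((n - 1)⁻¹) * √(2 * L) * √(2 * L / n)
        ≤ √((n - 1)⁻¹) * √(2 * L) * √(2 * L / (n - 1)) := by
          gcongr
          linarith
      _ = 2 * L / (n - 1) := by
          rw [← Real.sqrt_mul (by positivity), inv_mul_eq_div, Real.mul_self_sqrt (by positivity)]
  have h4 : 2 / 3 * M * L / n ≤ 2 / 3 * M * L / (n - 1) := by
    gcongr
    linarith
  rw [Real.sqrt_mul (by positivity)]
  calc D ≤ √((n - 1)⁻¹) * (√Q + M * √(2 * L)) * √(2 * L / n) + 2 / 3 * M * L / (n - 1) := by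
        linarith
    _ = √((n - 1)⁻¹) * √Q * √(2 * L / n) + M * (√((n - 1)⁻¹) * √(2 * L) * √(2 * L / n))
          + 2 / 3 * M * L / (n - 1) := by ring
    _ ≤ √((n - 1)⁻¹) * √Q * √(2 * L / n) + M * (2 * L / (n - 1))
          + 2 / 3 * M * L / (n - 1) := by gcongr
    _ = _ := by field_simp; ring

/-- An empirical Bernstein inequality. -/
theorem empirical_bernstein {X : ι → Ω → ℝ} (hX : iIndepFun X μ)
    (hm : ∀ i, Measurable (X i)) {K L : ℝ} (hK : 0 < K) (hL : 0 < L)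
    (hb : ∀ i, ∀ᵐ ω ∂μ, |X i ω| ≤ K) (hn : 2 ≤ Fintype.card ι) :
    μ.real {ω | √(((Fintype.card ι : ℝ) - 1)⁻¹ *
            ∑ i, (X i ω - (Fintype.card ι : ℝ)⁻¹ * ∑ j, X j ω) ^ 2) * √(2 * L / Fintype.card ι)
          + 8 * (2 * K) * L / (3 * ((Fintype.card ι : ℝ) - 1))
        < |(Fintype.card ι : ℝ)⁻¹ * ∑ i, X i ω
            - (Fintype.card ι : ℝ)⁻¹ * ∑ i, ∫ ω', X i ω' ∂μ|} ≤ 3 * Real.exp (-L) := by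
  have : Nonempty ι := Fintype.card_pos_iff.1 (by omega)
  have hn2 : (2 : ℝ) ≤ Fintype.card ι := by exact_mod_cast hn
  have hn0 : (0 : ℝ) < Fintype.card ι := by linarith
  have h2 : ∀ i, MemLp (X i) 2 μ := fun i => MemLp.of_bound (hm i).aestronglyMeasurable K (hb i)
  have hE : ∀ i, |∫ ω, X i ω ∂μ| ≤ K := fun i => by
    have := norm_integral_le_of_norm_le_const (μ := μ) (f := X i) (C := K) (hb i)
    simpa using this
  have hc : ∀ i, ∀ᵐ ω ∂μ, |X i ω - ∫ ω', X i ω' ∂μ| ≤ 2 * K := fun i => by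
    filter_upwards [hb i] with ω h
    exact (abs_sub _ _).trans (by linarith [hE i])
  have hd : ∀ i j, ∀ᵐ ω ∂μ, |X i ω - X j ω| ≤ 2 * K := fun i j => by
    filter_upwards [hb i, hb j] with ω h h'
    exact (abs_sub _ _).trans (by linarith)
  set S := ∑ i, variance (X i) μ with hS
  have hS0 : 0 ≤ S := Finset.sum_nonneg fun i _ => variance_nonneg _ _
  have h2K : 0 < 2 * K := by positivity
  have b1 := bernstein_sum hX hm h2K hL hc
  have hXn : iIndepFun (fun i ω => -X i ω) μ :=
    hX.comp (fun _ x => -x) fun _ => measurable_neg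
  have b2 := bernstein_sum (X := fun i ω => -X i ω) hXn (fun i => (hm i).neg) h2K hL
    (fun i => by
      filter_upwards [hc i] with ω h
      rw [integral_neg, ← abs_neg]
      convert h using 2
      ring)
  simp only [variance_fun_neg, integral_neg] at b2
  have b3 := measureReal_sum_sq_sub_lt_le hX hm h2 h2K hL hd rfl
  rw [← hS] at b1 b2 b3
  set B1 := {ω | √(2 * S * L) + 2 / 3 * (2 * K) * L ≤ ∑ i, (X i ω - ∫ ω', X i ω' ∂μ)}
  set B2 := {ω | √(2 * S * L) + 2 / 3 * (2 * K) * L ≤ ∑ i, (-X i ω - -∫ ω', X i ω' ∂μ)}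
  set B3 := {ω | ∑ i, (X i ω - (Fintype.card ι : ℝ)⁻¹ * ∑ j, X j ω) ^ 2
    < ((Fintype.card ι : ℝ) - 1) / Fintype.card ι * S
      - 2 * K * √(2 * L * (((Fintype.card ι : ℝ) - 1) / Fintype.card ι * S))}
  -- The three bad events are the two tails of the mean and an underestimated variance.
  refine (measureReal_mono (s₂ := B1 ∪ B2 ∪ B3) ?_).trans ?_
  · intro ω hω
    by_contra hcon
    simp only [Set.mem_union, not_or] at hcon
    obtain ⟨⟨h1, h2'⟩, h3⟩ := hcon
    simp only [B1, B2, B3, Set.mem_ofPred_eq, not_le, not_lt] at h1 h2' h3 hω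
    have hQ0 : 0 ≤ ∑ i, (X i ω - (Fintype.card ι : ℝ)⁻¹ * ∑ j, X j ω) ^ 2 :=
      Finset.sum_nonneg fun i _ => sq_nonneg _
    refine absurd hω (not_lt.2 ?_)
    rw [← mul_sub, ← Finset.sum_sub_distrib, abs_le']
    constructor
    · refine empirical_bernstein_deterministic hn2 hS0 hL h2K ?_ hQ0 h3
      rw [mul_inv_cancel_left₀ hn0.ne']
      exact h1.le
    · refine empirical_bernstein_deterministic hn2 hS0 hL h2K ?_ hQ0 h3
      rw [mul_neg, mul_inv_cancel_left₀ hn0.ne', ← Finset.sum_neg_distrib]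
      refine le_trans (le_of_eq ?_) h2'.le
      exact Finset.sum_congr rfl fun i _ => by ring
  · calc μ.real (B1 ∪ B2 ∪ B3) ≤ μ.real B1 + μ.real B2 + μ.real B3 :=
        (measureReal_union_le _ _).trans (by gcongr; exact measureReal_union_le _ _)
      _ ≤ 3 * Real.exp (-L) := by linarith

/-- A multiplicative upper tail for nonnegative variables. Applied to `(f_a - f_b)²` it bounds the
empirical second moment by a multiple of `d²`. -/
theorem measureReal_two_mul_integral_le {Y : ι → Ω → ℝ} (hY : iIndepFun Y μ)
    (hm : ∀ i, Measurable (Y i)) {b L : ℝ} (hb0 : 0 < b)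
    (h0 : ∀ i, ∀ᵐ ω ∂μ, 0 ≤ Y i ω) (hb : ∀ i, ∀ᵐ ω ∂μ, Y i ω ≤ b) :
    μ.real {ω | 2 * ∑ i, ∫ ω', Y i ω' ∂μ + b * L ≤ ∑ i, Y i ω} ≤ Real.exp (-L) := by
  have hY' : iIndepFun (fun i ω => Y i ω / b) μ := hY.comp (fun _ x => x / b) fun _ => by fun_prop
  have h := measureReal_sum_ge_le_exp_neg hY' (fun i => by fun_prop) (b := 1)
    (c := fun i => 2 / b * ∫ ω', Y i ω' ∂μ) (fun i => ?_)
    (fun i => integral_exp_div_bound_le (hm i) hb0 (h0 i) (hb i)) L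
  · refine (measureReal_mono ?_).trans h
    intro ω hω
    simp only [Set.mem_ofPred_eq] at hω ⊢
    rw [← Finset.mul_sum, ← Finset.sum_div, le_div_iff₀ hb0]
    refine le_trans (le_of_eq ?_) hω
    field_simp
  · filter_upwards [h0 i, hb i] with ω h1 h2
    rw [abs_div, abs_of_pos hb0, abs_of_nonneg h1]
    exact (div_le_one hb0).2 h2

end Concentration

/-! ### Propagation of errors through the tournament -/

section Tournament

variable {ι : Type*} {cmp : ι → ι → ι → Prop}

theorem exists_isRound (h : ∀ a b, ∃ c, cmp a b c) :
    ∀ l : List ι, ∃ l', IsRound cmp l l' ∧ l'.length = (l.length + 1) / 2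
  | [] => ⟨[], .nil, by simp⟩
  | [a] => ⟨[a], .bye a, by simp⟩
  | a :: b :: l => by
    obtain ⟨c, hc⟩ := h a b
    obtain ⟨l', hl', hlen⟩ := exists_isRound h l
    refine ⟨c :: l', .pair hc hl', ?_⟩
    simp only [List.length_cons, hlen]
    omega

theorem exists_isRounds_singleton (h : ∀ a b, ∃ c, cmp a b c) (n : ℕ) :
    ∀ l : List ι, l ≠ [] → l.length ≤ 2 ^ n → ∃ r, IsRounds cmp n l [r] := by
  induction n with
  | zero =>
    intro l hl hlen
    have : l.length = 1 := by
      have := List.length_pos_of_ne_nil hl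
      simp only [pow_zero] at hlen
      omega
    obtain ⟨r, rfl⟩ := List.length_eq_one_iff.1 this
    exact ⟨r, .zero _⟩
  | succ n ih =>
    intro l hl hlen
    obtain ⟨l', hl', hlen'⟩ := exists_isRound h l
    have hpos := List.length_pos_of_ne_nil hl
    rw [pow_succ] at hlen
    obtain ⟨r, hr⟩ := ih l' (List.ne_nil_of_length_pos (by omega)) (by omega)
    exact ⟨r, .succ (List.Perm.refl l) hl' hr⟩

theorem IsRound.exists_le {v : ι → ℝ} {e : ℝ} (he : 0 ≤ e)
    (h : ∀ a b c, cmp a b c → v c ≤ v a + e ∧ v c ≤ v b + e) {l l' : List ι}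
    (hl : IsRound cmp l l') : ∀ x ∈ l, ∃ y ∈ l', v y ≤ v x + e := by
  induction hl with
  | nil => simp
  | bye a => simpa using he
  | @pair a b c l l' hc _ ih =>
    intro x hx
    simp only [List.mem_cons] at hx
    rcases hx with rfl | rfl | hx
    · exact ⟨c, by simp, (h _ _ _ hc).1⟩
    · exact ⟨c, by simp, (h _ _ _ hc).2⟩
    · obtain ⟨y, hy, hxy⟩ := ih x hx
      exact ⟨y, by simp [hy], hxy⟩

/-- Following an initial model `x`, whoever replaces it in a round is worse by at most `e`, so some
survivor stays within `n * e` of it. -/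
theorem IsRounds.exists_le {v : ι → ℝ} {e : ℝ} (he : 0 ≤ e)
    (h : ∀ a b c, cmp a b c → v c ≤ v a + e ∧ v c ≤ v b + e) {n : ℕ} {l l' : List ι}
    (hl : IsRounds cmp n l l') : ∀ x ∈ l, ∃ y ∈ l', v y ≤ v x + n * e := by
  induction hl with
  | zero l => intro x hx; exact ⟨x, hx, by simp⟩
  | succ hp hr _ ih =>
    intro x hx
    obtain ⟨y, hy, hxy⟩ := hr.exists_le he h x (hp.mem_iff.1 hx)
    obtain ⟨w, hw, hyw⟩ := ih y hy
    refine ⟨w, hw, ?_⟩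
    push_cast
    linarith

end Tournament

/-! ### The adaptive window: a deterministic analysis -/

section Window

variable {B : ℕ → ℕ} {u : (j : ℕ) → Fin (B j) → ℝ} {M δ' : ℝ} {t : ℕ}

theorem one_le_winSize (hB : ∀ j ∈ Finset.Icc 1 t, 1 ≤ B j) {k : ℕ} (hk : k ∈ Finset.Icc 1 t) :
    1 ≤ winSize B t k := by
  rw [Finset.mem_Icc] at hk
  have ht : t ∈ window t k := Finset.mem_Icc.2 ⟨by omega, le_rfl⟩
  calc 1 ≤ B t := hB t (Finset.mem_Icc.2 ⟨by omega, le_rfl⟩)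
    _ ≤ winSize B t k := Finset.single_le_sum (f := B) (fun _ _ => Nat.zero_le _) ht

theorem window_subset (t k : ℕ) : window t k ⊆ Finset.Icc 1 t :=
  Finset.Icc_subset_Icc (by omega) le_rfl

theorem window_mono {i k : ℕ} (h : i ≤ k) : window t i ⊆ window t k :=
  Finset.Icc_subset_Icc (by omega) le_rfl

theorem psiHat_nonneg (hM : 0 ≤ M) (hL : 0 ≤ Real.log (2 / δ')) {k : ℕ}
    (hk : 1 ≤ winSize B t k) : 0 ≤ psiHat u M δ' t k := by
  unfold psiHat
  split_ifs
  · exact hM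
  · have : (1 : ℝ) ≤ winSize B t k := by exact_mod_cast hk
    have h1 : (0 : ℝ) ≤ 3 * ((winSize B t k : ℝ) - 1) := by linarith
    positivity

theorem phiHat_nonneg {k : ℕ} : 0 ≤ phiHat u M δ' t k :=
  Real.iSup_nonneg fun _ => le_max_right _ _

theorem abs_winMean_sub_le_phiHat {i k : ℕ} (hi : i ∈ Finset.Icc 1 k) :
    |winMean u t k - winMean u t i| - (psiHat u M δ' t k + psiHat u M δ' t i)
      ≤ phiHat u M δ' t k :=
  (le_max_left _ _).trans (le_ciSup (f := fun i : Finset.Icc 1 k =>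
    max (|winMean u t k - winMean u t i| - (psiHat u M δ' t k + psiHat u M δ' t i)) 0)
    (Set.finite_range _).bddAbove ⟨i, hi⟩)

theorem exists_isSelectedWindow (u : (j : ℕ) → Fin (B j) → ℝ) (M δ' : ℝ) (ht : 1 ≤ t) :
    ∃ k, IsSelectedWindow u M δ' t k :=
  Finset.exists_min_image (Finset.Icc 1 t) _ ⟨1, Finset.mem_Icc.2 ⟨le_rfl, ht⟩⟩

/-- The selected window adapts to the best trade-off of bias and stochastic error. -/
theorem IsSelectedWindow.abs_winMean_sub_le {s : ℕ} (hs : IsSelectedWindow u M δ' t s)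
    {Δ : ℝ} {b : ℕ → ℝ} (hb0 : ∀ k ∈ Finset.Icc 1 t, 0 ≤ b k)
    (hbm : ∀ i ∈ Finset.Icc 1 t, ∀ k ∈ Finset.Icc 1 t, i ≤ k → b i ≤ b k)
    (hψ : ∀ k ∈ Finset.Icc 1 t, 0 ≤ psiHat u M δ' t k)
    (hdev : ∀ k ∈ Finset.Icc 1 t, |winMean u t k - Δ| ≤ psiHat u M δ' t k + b k)
    {k : ℕ} (hk : k ∈ Finset.Icc 1 t) :
    |winMean u t s - Δ| ≤ 3 * b k + 3 * psiHat u M δ' t k := by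
  obtain ⟨hst, hmin⟩ := hs
  -- In the triangle inequality through `Δ` the two stochastic errors are offset by the two
  -- subtracted `ψ̂` terms, leaving `b k + b i`.
  have hφ : phiHat u M δ' t k ≤ 2 * b k := by
    refine Real.iSup_le (fun ⟨i, hi⟩ => max_le ?_ ?_) (by linarith [hb0 k hk])
    · rw [Finset.mem_Icc] at hi hk
      have hit : i ∈ Finset.Icc 1 t := Finset.mem_Icc.2 ⟨hi.1, hi.2.trans hk.2⟩
      have h1 := hdev k (Finset.mem_Icc.2 hk)
      have h2 := hdev i hit
      have h3 := hbm i hit k (Finset.mem_Icc.2 hk) hi.2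
      have h4 := abs_sub_le (winMean u t k) Δ (winMean u t i)
      rw [abs_sub_comm Δ] at h4
      dsimp only
      linarith
    · linarith [hb0 k hk]
  have h1 := hmin k hk
  have h2 := hdev k hk
  have h3 := hψ k hk
  have h4 := hb0 k hk
  -- If the selected window is the longer one, `φ̂ s` compares it with window `k`. If it is shorter,
  -- its bias is at most `b k` and its `ψ̂` is at most the minimal value of the criterion.
  rcases le_or_gt k s with hks | hks
  · have h5 := abs_winMean_sub_le_phiHat (u := u) (M := M) (δ' := δ') (t := t)
      (Finset.mem_Icc.2 ⟨(Finset.mem_Icc.1 hk).1, hks⟩)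
    have h6 := abs_sub_le (winMean u t s) (winMean u t k) Δ
    linarith
  · have h5 := hdev s hst
    have h6 := hbm s hst k hk hks.le
    have h7 : 0 ≤ phiHat u M δ' t s := phiHat_nonneg
    linarith

theorem winVar_le {k : ℕ} (hk : 2 ≤ winSize B t k) :
    winVar u t k ≤ ((winSize B t k : ℝ) - 1)⁻¹ * ∑ j ∈ window t k, ∑ i, u j i ^ 2 := by
  have hn : (2 : ℝ) ≤ winSize B t k := by exact_mod_cast hk
  unfold winVar
  refine mul_le_mul_of_nonneg_left ?_ (inv_nonneg.2 (by linarith))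
  set c := winMean u t k with hc
  have e : ∑ j ∈ window t k, ∑ i, (u j i - c) ^ 2
      = ∑ j ∈ window t k, ∑ i, u j i ^ 2 - 2 * c * ∑ j ∈ window t k, ∑ i, u j i
        + winSize B t k * c ^ 2 := by
    have : ∀ j i, (u j i - c) ^ 2 = u j i ^ 2 - 2 * c * u j i + c ^ 2 := fun j i => by ring
    simp only [this, Finset.sum_sub_distrib, Finset.sum_add_distrib, Finset.sum_const,
      Finset.card_univ, Fintype.card_fin, nsmul_eq_mul, ← Finset.mul_sum, ← Finset.sum_mul,
      winSize, Nat.cast_sum]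
  have hs : ∑ j ∈ window t k, ∑ i, u j i = winSize B t k * c := by
    rw [hc, winMean, mul_inv_cancel_left₀ (by positivity : (winSize B t k : ℝ) ≠ 0)]
  rw [e, hs]
  have : 0 ≤ (winSize B t k : ℝ) * c ^ 2 := by positivity
  linarith

/-- With second moment of order `M₀² d²`, the leading term of `ψ̂` is proportional to `d √(L/n)`;
the rest is of order `L/n`. When the window holds one sample, `ψ̂ = 8 M₀²` is covered by the last
term because `L ≥ 1`. -/
theorem psiHat_le {M₀ d : ℝ} (hM₀ : 0 < M₀) (hd : 0 ≤ d) (hL : 1 ≤ Real.log (2 / δ')) {k : ℕ}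
    (hk : 1 ≤ winSize B t k)
    (hu : ∑ j ∈ window t k, ∑ i, u j i ^ 2
      ≤ 16 * M₀ ^ 2 * (2 * (winSize B t k * d ^ 2) + 4 * M₀ ^ 2 * Real.log (2 / δ'))) :
    psiHat u (8 * M₀ ^ 2) δ' t k
      ≤ 12 * M₀ * d * √(Real.log (2 / δ') / winSize B t k)
        + 61 * M₀ ^ 2 * (Real.log (2 / δ') / winSize B t k) := by
  set L := Real.log (2 / δ') with hLdef
  unfold psiHat
  split_ifs with h1
  · rw [h1]
    have : 0 ≤ 12 * M₀ * d * √(L / (1 : ℕ)) := by positivity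
    have : M₀ ^ 2 * 1 ≤ M₀ ^ 2 * L := by gcongr
    simp only [Nat.cast_one, div_one] at *
    nlinarith
  · have hk2 : 2 ≤ winSize B t k := by omega
    have hv := winVar_le (u := u) hk2
    set n : ℝ := (winSize B t k : ℝ) with hn
    have hn2 : (2 : ℝ) ≤ n := by rw [hn]; exact_mod_cast hk2
    have hn1 : 0 < n - 1 := by linarith
    have hn0 : 0 < n := by linarith
    rw [← hLdef]
    set s := √(L / n) with hs
    have hs2 : s ^ 2 = L / n := Real.sq_sqrt (by positivity)
    have hs0 : 0 ≤ s := Real.sqrt_nonneg _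
    have hinv : (n - 1)⁻¹ ≤ 2 / n := by
      rw [inv_eq_one_div, div_le_div_iff₀ hn1 hn0]; linarith
    have hV : winVar u t k ≤ (8 * M₀ * d + 12 * M₀ ^ 2 * s) ^ 2 := by
      calc winVar u t k ≤ (n - 1)⁻¹ * (16 * M₀ ^ 2 * (2 * (n * d ^ 2) + 4 * M₀ ^ 2 * L)) :=
            hv.trans (mul_le_mul_of_nonneg_left hu (inv_nonneg.2 hn1.le))
        _ ≤ 2 / n * (16 * M₀ ^ 2 * (2 * (n * d ^ 2) + 4 * M₀ ^ 2 * L)) := by gcongr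
        _ = 64 * M₀ ^ 2 * d ^ 2 + 128 * M₀ ^ 4 * s ^ 2 := by
            rw [hs2]; field_simp; ring
        _ ≤ (8 * M₀ * d + 12 * M₀ ^ 2 * s) ^ 2 := by
            have : 0 ≤ 192 * (M₀ * d) * (M₀ ^ 2 * s) + 16 * M₀ ^ 4 * s ^ 2 := by positivity
            nlinarith
    have hsV : √(winVar u t k) ≤ 8 * M₀ * d + 12 * M₀ ^ 2 * s := by
      rw [← Real.sqrt_sq (show 0 ≤ 8 * M₀ * d + 12 * M₀ ^ 2 * s by positivity)]
      exact Real.sqrt_le_sqrt hV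
    have h2s : √(2 * L / n) ≤ 3 / 2 * s := by
      rw [← Real.sqrt_sq (show 0 ≤ 3 / 2 * s by positivity)]
      apply Real.sqrt_le_sqrt
      rw [mul_pow, hs2, mul_div_assoc]
      have : 0 ≤ L / n := by positivity
      linarith
    have h3 : 8 * (8 * M₀ ^ 2) * L / (3 * (n - 1)) ≤ 43 * M₀ ^ 2 * s ^ 2 := by
      have : 8 * (8 * M₀ ^ 2) * L / (3 * (n - 1)) = 64 / 3 * M₀ ^ 2 * L * (n - 1)⁻¹ := by
        field_simp; ring
      rw [this]
      calc 64 / 3 * M₀ ^ 2 * L * (n - 1)⁻¹ ≤ 64 / 3 * M₀ ^ 2 * L * (2 / n) := by gcongr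
        _ = 128 / 3 * M₀ ^ 2 * s ^ 2 := by rw [hs2]; ring
        _ ≤ 43 * M₀ ^ 2 * s ^ 2 := by gcongr; norm_num
    calc _ ≤ (8 * M₀ * d + 12 * M₀ ^ 2 * s) * (3 / 2 * s) + 43 * M₀ ^ 2 * s ^ 2 := by
          gcongr
      _ = _ := by rw [← hs2]; ring

end Window

/-- If `a - b > (C+1) ε`, then also `a + b > (C+1) ε`, and multiplying the excess `a - b - C ε > ε`
by `a + b` contradicts the hypothesis. -/
theorem le_add_of_sq_sub_sq_le {a b C ε : ℝ} (hC : 0 ≤ C) (hb : 0 ≤ b)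
    (hε : 0 < ε) (h : a ^ 2 - b ^ 2 ≤ C * ((a + b) * ε + ε ^ 2)) : a ≤ b + (C + 1) * ε := by
  by_contra hcon
  push Not at hcon
  have h1 : ε < a - b - C * ε := by linarith
  have h2 : (C + 1) * ε < a + b := by linarith
  have h3 : ε * ((C + 1) * ε) < (a - b - C * ε) * (a + b) :=
    mul_lt_mul'' h1 h2 hε.le (by positivity)
  nlinarith [sq_nonneg ε]

/-- The winner of a comparison is nearly as good as the loser. -/
theorem IsComparisonOutput.le_add {X : Type*} {B : ℕ → ℕ} {m : ℕ}
    {data : (j : ℕ) → Fin (B j) → X × ℝ} {M δ' : ℝ} {t : ℕ} {f : Fin m → X → ℝ} {a b c : Fin m}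
    (h : IsComparisonOutput data M δ' t f a b c) {v : Fin m → ℝ} (hv : ∀ r, 0 ≤ v r)
    {C ε : ℝ} (hC : 0 ≤ C) (hε : 0 < ε)
    (hdev : ∀ k, IsSelectedWindow (lossDiff data (f a) (f b)) M δ' t k →
      |winMean (lossDiff data (f a) (f b)) t k - (v a ^ 2 - v b ^ 2)|
        ≤ C * ((v a + v b) * ε + ε ^ 2)) :
    v c ≤ v a + (C + 1) * ε ∧ v c ≤ v b + (C + 1) * ε := by
  obtain ⟨k, hk, hc⟩ := h
  have h1 := abs_le.1 (hdev k hk)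
  have h2 : 0 ≤ (C + 1) * ε := by positivity
  split_ifs at hc with h3
  · subst hc
    exact ⟨by linarith, le_add_of_sq_sub_sq_le hC (hv _) hε (by linarith)⟩
  · subst hc
    refine ⟨le_add_of_sq_sub_sq_le hC (hv _) hε ?_, by linarith⟩
    rw [add_comm (v c)]
    linarith

/-! ### Risk differences and regression functions -/

section Regression

variable {X : Type*} [MeasurableSpace X]

theorem l2norm_nonneg (PX : Measure X) (h : X → ℝ) : 0 ≤ l2norm PX h := Real.sqrt_nonneg _

theorem l2norm_sq (PX : Measure X) (h : X → ℝ) : l2norm PX h ^ 2 = ∫ x, h x * h x ∂PX :=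
  Real.sq_sqrt (integral_nonneg fun x => mul_self_nonneg (h x))

/-- Cauchy–Schwarz, from the discriminant of the nonnegative quadratic `s ↦ ∫ (s g + h)²`. -/
theorem abs_integral_mul_le {PX : Measure X} {g h : X → ℝ} (hg : MemLp g 2 PX)
    (hh : MemLp h 2 PX) : |∫ x, g x * h x ∂PX| ≤ l2norm PX g * l2norm PX h := by
  have hgg : Integrable (fun x => g x * g x) PX := hg.integrable_mul hg
  have hgh : Integrable (fun x => g x * h x) PX := hg.integrable_mul hh
  have hhh : Integrable (fun x => h x * h x) PX := hh.integrable_mul hh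
  have hd := discrim_le_zero (a := ∫ x, g x * g x ∂PX) (b := 2 * ∫ x, g x * h x ∂PX)
    (c := ∫ x, h x * h x ∂PX) fun s => by
      have e : ∫ x, (s * g x + h x) * (s * g x + h x) ∂PX
          = (∫ x, g x * g x ∂PX) * (s * s) + (2 * ∫ x, g x * h x ∂PX) * s
            + ∫ x, h x * h x ∂PX := by
        have : (fun x => (s * g x + h x) * (s * g x + h x))
            = fun x => s * s * (g x * g x) + 2 * s * (g x * h x) + h x * h x := by
          funext x; ring
        rw [this, integral_add (by fun_prop) hhh, integral_add (by fun_prop) (by fun_prop),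
          integral_const_mul, integral_const_mul]
        ring
      rw [← e]
      exact integral_nonneg fun x => mul_self_nonneg _
  rw [discrim] at hd
  rw [l2norm, l2norm, ← Real.sqrt_mul (integral_nonneg fun x => mul_self_nonneg (g x))]
  apply Real.abs_le_sqrt
  linarith

/-- A triangle inequality with a spare factor 2, from `(x - y)² ≤ 2x² + 2y²`. -/
theorem l2norm_sub_le {PX : Measure X} {f g r : X → ℝ} (hf : MemLp f 2 PX) (hg : MemLp g 2 PX)
    (hr : MemLp r 2 PX) :
    l2norm PX (fun x => f x - g x)
      ≤ 2 * (l2norm PX (fun x => f x - r x) + l2norm PX (fun x => g x - r x)) := by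
  have h1 : Integrable (fun x => (f x - r x) * (f x - r x)) PX :=
    (hf.sub hr).integrable_mul (hf.sub hr)
  have h2 : Integrable (fun x => (g x - r x) * (g x - r x)) PX :=
    (hg.sub hr).integrable_mul (hg.sub hr)
  have h3 : Integrable (fun x => (f x - g x) * (f x - g x)) PX :=
    (hf.sub hg).integrable_mul (hf.sub hg)
  have h4 : ∫ x, (f x - g x) * (f x - g x) ∂PX
      ≤ ∫ x, (2 * ((f x - r x) * (f x - r x)) + 2 * ((g x - r x) * (g x - r x))) ∂PX := by
    refine integral_mono h3 ((h1.const_mul 2).add (h2.const_mul 2)) fun x => ?_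
    simp only
    nlinarith [sq_nonneg (f x + g x - 2 * r x)]
  rw [integral_add (h1.const_mul 2) (h2.const_mul 2), integral_const_mul, integral_const_mul] at h4
  have ha := l2norm_nonneg PX fun x => f x - r x
  have hb := l2norm_nonneg PX fun x => g x - r x
  rw [← l2norm_sq PX fun x => f x - r x, ← l2norm_sq PX fun x => g x - r x] at h4
  rw [l2norm]
  apply Real.sqrt_le_iff.2
  refine ⟨by positivity, h4.trans ?_⟩
  nlinarith [mul_nonneg ha hb]

variable {P : Measure (X × ℝ)} [IsProbabilityMeasure P] {PX : Measure X} {M₀ : ℝ}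

theorem aestronglyMeasurable_regFun (hP : P.map Prod.fst = PX) :
    AEStronglyMeasurable (regFun P) PX := by
  rw [← hP]
  exact (measurable_snd.aestronglyMeasurable (μ := P)).integral_condKernel

theorem ae_abs_regFun_le (hP : P.map Prod.fst = PX) (hb : ∀ᵐ w ∂P, |w.2| ≤ M₀) :
    ∀ᵐ x ∂PX, |regFun P x| ≤ M₀ := by
  rw [← hP]
  have h : ∀ᵐ w ∂(P.fst ⊗ₘ P.condKernel), |w.2| ≤ M₀ := by
    rwa [P.disintegrate P.condKernel]
  filter_upwards [Measure.ae_ae_of_ae_compProd h] with x hx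
  have := norm_integral_le_of_norm_le_const (μ := P.condKernel x) (f := fun y => y) (C := M₀) hx
  simpa [regFun] using this

theorem memLp_regFun (hP : P.map Prod.fst = PX) (hb : ∀ᵐ w ∂P, |w.2| ≤ M₀) :
    MemLp (regFun P) 2 PX := by
  have : IsFiniteMeasure PX := by rw [← hP]; infer_instance
  exact MemLp.of_bound (aestronglyMeasurable_regFun hP) M₀ (ae_abs_regFun_le hP hb)

theorem integral_mul_snd (hP : P.map Prod.fst = PX) {h : X → ℝ}
    (hi : Integrable (fun w : X × ℝ => h w.1 * w.2) P) :
    ∫ w, h w.1 * w.2 ∂P = ∫ x, h x * regFun P x ∂PX := by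
  rw [← hP, ← Measure.integral_condKernel hi]
  refine integral_congr_ae (ae_of_all _ fun x => ?_)
  simp only [regFun]
  rw [integral_const_mul]

/-- The terms `y²` cancel, so the risk gap depends on `P` only through its marginal and, linearly,
its regression function. -/
theorem integral_sqLoss_sub (hP : P.map Prod.fst = PX) (hb : ∀ᵐ w ∂P, |w.2| ≤ M₀)
    {f g : X → ℝ} (hf : Measurable f) (hg : Measurable g) (hfb : ∀ x, |f x| ≤ M₀)
    (hgb : ∀ x, |g x| ≤ M₀) :
    ∫ w, (sqLoss f w - sqLoss g w) ∂P
      = ∫ x, (f x - g x) * (f x + g x) ∂PX - 2 * ∫ x, (f x - g x) * regFun P x ∂PX := by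
  have hf2 : MemLp (fun w : X × ℝ => f w.1) 2 P :=
    MemLp.of_bound (hf.comp measurable_fst).aestronglyMeasurable M₀ (ae_of_all _ fun w => hfb w.1)
  have hg2 : MemLp (fun w : X × ℝ => g w.1) 2 P :=
    MemLp.of_bound (hg.comp measurable_fst).aestronglyMeasurable M₀ (ae_of_all _ fun w => hgb w.1)
  have hy2 : MemLp (fun w : X × ℝ => w.2) 2 P := MemLp.of_bound (by fun_prop) M₀ hb
  have h1 : Integrable (fun w : X × ℝ => (f w.1 - g w.1) * (f w.1 + g w.1)) P :=
    (hf2.sub hg2).integrable_mul (hf2.add hg2)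
  have h2 : Integrable (fun w : X × ℝ => (f w.1 - g w.1) * w.2) P :=
    (hf2.sub hg2).integrable_mul hy2
  have e : (fun w : X × ℝ => sqLoss f w - sqLoss g w)
      = fun w => (f w.1 - g w.1) * (f w.1 + g w.1) - 2 * ((f w.1 - g w.1) * w.2) := by
    funext w; simp only [sqLoss]; ring
  rw [e, integral_sub h1 (h2.const_mul 2), integral_const_mul,
    integral_mul_snd (h := fun x => f x - g x) hP h2, ← hP,
    integral_map (f := fun x => (f x - g x) * (f x + g x)) (by fun_prop) (by fun_prop)]

theorem integral_sqLoss_sub_eq_l2norm (hP : P.map Prod.fst = PX) (hb : ∀ᵐ w ∂P, |w.2| ≤ M₀)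
    {f g : X → ℝ} (hf : Measurable f) (hg : Measurable g) (hfb : ∀ x, |f x| ≤ M₀)
    (hgb : ∀ x, |g x| ≤ M₀) :
    ∫ w, (sqLoss f w - sqLoss g w) ∂P
      = l2norm PX (fun x => f x - regFun P x) ^ 2 - l2norm PX (fun x => g x - regFun P x) ^ 2 := by
  have : IsFiniteMeasure PX := by rw [← hP]; infer_instance
  have hf2 : MemLp f 2 PX := MemLp.of_bound (by fun_prop) M₀ (ae_of_all _ hfb)
  have hg2 : MemLp g 2 PX := MemLp.of_bound (by fun_prop) M₀ (ae_of_all _ hgb)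
  have hr2 := memLp_regFun hP hb
  have h1 : Integrable (fun x => (f x - g x) * (f x + g x)) PX :=
    (hf2.sub hg2).integrable_mul (hf2.add hg2)
  have h2 : Integrable (fun x => 2 * ((f x - g x) * regFun P x)) PX :=
    ((hf2.sub hg2).integrable_mul hr2).const_mul 2
  have h3 : Integrable (fun x => (f x - regFun P x) * (f x - regFun P x)) PX :=
    (hf2.sub hr2).integrable_mul (hf2.sub hr2)
  have h4 : Integrable (fun x => (g x - regFun P x) * (g x - regFun P x)) PX :=
    (hg2.sub hr2).integrable_mul (hg2.sub hr2)
  rw [integral_sqLoss_sub hP hb hf hg hfb hgb, l2norm_sq, l2norm_sq, ← integral_const_mul,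
    ← integral_sub h1 h2, ← integral_sub h3 h4]
  refine integral_congr_ae (ae_of_all _ fun x => ?_)
  simp only
  ring

/-- With a common marginal only the regression term changes, and Cauchy–Schwarz makes the bias
proportional to the distance of the two models. -/
theorem abs_integral_sqLoss_sub_sub_le {P' : Measure (X × ℝ)} [IsProbabilityMeasure P']
    (hP : P.map Prod.fst = PX) (hb : ∀ᵐ w ∂P, |w.2| ≤ M₀)
    (hP' : P'.map Prod.fst = PX) (hb' : ∀ᵐ w ∂P', |w.2| ≤ M₀)
    {f g : X → ℝ} (hf : Measurable f) (hg : Measurable g) (hfb : ∀ x, |f x| ≤ M₀)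
    (hgb : ∀ x, |g x| ≤ M₀) :
    |∫ w, (sqLoss f w - sqLoss g w) ∂P' - ∫ w, (sqLoss f w - sqLoss g w) ∂P|
      ≤ 2 * (l2norm PX (fun x => f x - g x)
        * l2norm PX (fun x => regFun P' x - regFun P x)) := by
  have : IsFiniteMeasure PX := by rw [← hP]; infer_instance
  have hf2 : MemLp f 2 PX := MemLp.of_bound (by fun_prop) M₀ (ae_of_all _ hfb)
  have hg2 : MemLp g 2 PX := MemLp.of_bound (by fun_prop) M₀ (ae_of_all _ hgb)
  have hr2 := memLp_regFun hP hb
  have hr2' := memLp_regFun hP' hb'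
  have h := abs_integral_mul_le (hf2.sub hg2) (hr2'.sub hr2)
  have e : ∫ x, (f - g) x * (regFun P' - regFun P) x ∂PX
      = ∫ x, (f x - g x) * regFun P' x ∂PX - ∫ x, (f x - g x) * regFun P x ∂PX := by
    have h1 : Integrable (fun x => (f x - g x) * regFun P' x) PX :=
      (hf2.sub hg2).integrable_mul hr2'
    have h2 : Integrable (fun x => (f x - g x) * regFun P x) PX :=
      (hf2.sub hg2).integrable_mul hr2
    rw [← integral_sub h1 h2]
    refine integral_congr_ae (ae_of_all _ fun x => ?_)
    simp only [Pi.sub_apply]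
    ring
  rw [e] at h
  rw [integral_sqLoss_sub hP hb hf hg hfb hgb, integral_sqLoss_sub hP' hb' hf hg hfb hgb]
  have e2 : ∀ A x y : ℝ, A - 2 * x - (A - 2 * y) = -(2 * (x - y)) := fun A x y => by ring
  rw [e2, abs_neg, abs_mul, abs_two]
  exact mul_le_mul_of_nonneg_left h zero_le_two

end Regression

/-! ### Sums and averages over a window -/

section WindowSums

variable {B : ℕ → ℕ} {t k : ℕ}

theorem sum_window_eq_sum_sigma (F : (j : ℕ) → Fin (B j) → ℝ) :
    ∑ j ∈ window t k, ∑ i, F j i = ∑ s : (j : window t k) × Fin (B j), F s.1 s.2 := by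
  rw [Fintype.sum_sigma, Finset.sum_coe_sort (window t k) fun j => ∑ i, F j i]

theorem card_window_sigma : Fintype.card ((j : window t k) × Fin (B j)) = winSize B t k := by
  rw [Fintype.card_sigma]
  simp only [Fintype.card_fin]
  exact Finset.sum_coe_sort (window t k) B

theorem abs_inv_winSize_mul_sum_le {F : (j : ℕ) → Fin (B j) → ℝ} {K : ℝ}
    (hk : 1 ≤ winSize B t k) (hF : ∀ j ∈ window t k, ∀ i, |F j i| ≤ K) :
    |(winSize B t k : ℝ)⁻¹ * ∑ j ∈ window t k, ∑ i, F j i| ≤ K := by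
  have hn : (0 : ℝ) < winSize B t k := by exact_mod_cast hk
  rw [abs_mul, abs_inv, abs_of_pos hn, inv_mul_le_iff₀ hn]
  calc |∑ j ∈ window t k, ∑ i, F j i| ≤ ∑ j ∈ window t k, ∑ _i : Fin (B j), K :=
        (Finset.abs_sum_le_sum_abs _ _).trans (Finset.sum_le_sum fun j hj =>
          (Finset.abs_sum_le_sum_abs _ _).trans (Finset.sum_le_sum fun i _ => hF j hj i))
    _ = winSize B t k * K := by
        simp [winSize, ← Finset.sum_mul]

theorem abs_inv_winSize_mul_sum_sub_le {D : ℕ → ℝ} {Δ b : ℝ}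
    (hk : 1 ≤ winSize B t k) (hD : ∀ j ∈ window t k, |D j - Δ| ≤ b) :
    |(winSize B t k : ℝ)⁻¹ * ∑ j ∈ window t k, B j * D j - Δ| ≤ b := by
  have hn : (0 : ℝ) < winSize B t k := by exact_mod_cast hk
  have h := abs_inv_winSize_mul_sum_le (F := fun j (_ : Fin (B j)) => D j - Δ) hk
    fun j hj _ => hD j hj
  convert h using 2
  simp only [Finset.sum_const, Finset.card_univ, Fintype.card_fin, nsmul_eq_mul, mul_sub,
    Finset.sum_sub_distrib, ← Finset.sum_mul]
  rw [← Nat.cast_sum]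
  change _ = _ - (winSize B t k : ℝ)⁻¹ * ((winSize B t k : ℝ) * Δ)
  rw [inv_mul_cancel_left₀ hn.ne']

end WindowSums

/-! ### Deviation events for one comparison and one window -/

section Events

variable {X : Type*} [MeasurableSpace X] {Ω : Type*} [MeasurableSpace Ω] {μ : Measure Ω}
  {t : ℕ} {B : ℕ → ℕ} {z : (j : ℕ) → Fin (B j) → Ω → X × ℝ}

theorem iIndepFun_window
    (hz : iIndepFun (fun (s : (j : Finset.Icc 1 t) × Fin (B j)) => z s.1 s.2) μ)
    (k : ℕ) {g : X × ℝ → ℝ} (hg : Measurable g) :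
    iIndepFun (fun (s : (j : window t k) × Fin (B j)) ω => g (z s.1 s.2 ω)) μ := by
  have hinj : Function.Injective (fun s : (j : window t k) × Fin (B j) =>
      (⟨⟨s.1, window_subset t k s.1.2⟩, s.2⟩ : (j : Finset.Icc 1 t) × Fin (B j))) := by
    rintro ⟨⟨j, hj⟩, i⟩ ⟨⟨j', hj'⟩, i'⟩ h
    simp only [Sigma.mk.injEq, Subtype.mk.injEq] at h
    obtain ⟨rfl, h⟩ := h
    simp only [heq_eq_eq] at h
    rw [h]
  exact (hz.precomp hinj).comp (fun _ => g) fun _ => hg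

variable [IsProbabilityMeasure μ]

theorem measureReal_psiHat_lt_le
    (hz : iIndepFun (fun (s : (j : Finset.Icc 1 t) × Fin (B j)) => z s.1 s.2) μ)
    (hzm : ∀ j ∈ Finset.Icc 1 t, ∀ i, Measurable (z j i))
    {g : X × ℝ → ℝ} (hg : Measurable g) {K δ' : ℝ} (hK : 0 < K) (hL : 0 < Real.log (2 / δ'))
    (hb : ∀ j ∈ Finset.Icc 1 t, ∀ i, ∀ᵐ ω ∂μ, |g (z j i ω)| ≤ K) {D : ℕ → ℝ}
    (hD : ∀ j ∈ Finset.Icc 1 t, ∀ i, ∫ ω, g (z j i ω) ∂μ = D j) {k : ℕ}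
    (hk : 1 ≤ winSize B t k) :
    μ.real {ω | psiHat (fun j i => g (z j i ω)) (2 * K) δ' t k
      < |winMean (fun j i => g (z j i ω)) t k
          - (winSize B t k : ℝ)⁻¹ * ∑ j ∈ window t k, B j * D j|}
      ≤ 3 * Real.exp (-Real.log (2 / δ')) := by
  have hm : ∀ s : (j : window t k) × Fin (B j), Measurable fun ω => g (z s.1 s.2 ω) :=
    fun s => hg.comp (hzm _ (window_subset t k s.1.2) _)
  have hbs : ∀ s : (j : window t k) × Fin (B j), ∀ᵐ ω ∂μ, |g (z s.1 s.2 ω)| ≤ K :=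
    fun s => hb _ (window_subset t k s.1.2) _
  have hDsum : ∑ j ∈ window t k, (B j : ℝ) * D j
      = ∑ s : (j : window t k) × Fin (B j), ∫ ω, g (z s.1 s.2 ω) ∂μ := by
    rw [← sum_window_eq_sum_sigma fun j i => ∫ ω, g (z j i ω) ∂μ]
    refine Finset.sum_congr rfl fun j hj => ?_
    rw [Finset.sum_congr rfl fun i _ => hD j (window_subset t k hj) i]
    simp
  -- With a single sample `ψ̂ = 2K`, which bounds the deviation almost surely.
  by_cases h1 : winSize B t k = 1
  · have hnull : ∀ᵐ ω ∂μ, ω ∉ {ω | psiHat (fun j i => g (z j i ω)) (2 * K) δ' t k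
      < |winMean (fun j i => g (z j i ω)) t k
          - (winSize B t k : ℝ)⁻¹ * ∑ j ∈ window t k, B j * D j|} := by
      filter_upwards [ae_all_iff.2 hbs] with ω hω
      simp only [not_lt, psiHat, if_pos h1]
      refine (abs_sub _ _).trans ?_
      have e1 : |winMean (fun j i => g (z j i ω)) t k| ≤ K :=
        abs_inv_winSize_mul_sum_le hk fun j hj i => hω ⟨⟨j, hj⟩, i⟩
      have e2 : |(winSize B t k : ℝ)⁻¹ * ∑ j ∈ window t k, B j * D j| ≤ K := by
        rw [hDsum, ← sum_window_eq_sum_sigma fun j i => ∫ ω, g (z j i ω) ∂μ]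
        refine abs_inv_winSize_mul_sum_le hk fun j hj i => ?_
        have := norm_integral_le_of_norm_le_const (μ := μ) (f := fun ω => g (z j i ω)) (C := K)
          (hb j (window_subset t k hj) i)
        simpa using this
      linarith
    rw [measureReal_def, measure_eq_zero_iff_ae_notMem.2 hnull]
    simp [(Real.exp_pos _).le]
  · have h := empirical_bernstein (iIndepFun_window hz k hg) hm hK hL hbs
      (by rw [card_window_sigma]; omega)
    rw [card_window_sigma] at h
    convert h using 3
    ext ω
    rw [psiHat, if_neg h1, winVar, winMean, hDsum,
      sum_window_eq_sum_sigma fun j i => (g (z j i ω) - _) ^ 2,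
      sum_window_eq_sum_sigma fun j i => g (z j i ω)]

theorem measureReal_sum_sq_ge_le
    (hz : iIndepFun (fun (s : (j : Finset.Icc 1 t) × Fin (B j)) => z s.1 s.2) μ)
    (hzm : ∀ j ∈ Finset.Icc 1 t, ∀ i, Measurable (z j i))
    {g : X × ℝ → ℝ} (hg : Measurable g) {b L : ℝ} (hb0 : 0 < b)
    (h0 : ∀ w, 0 ≤ g w) (hb : ∀ w, g w ≤ b) {D : ℝ}
    (hD : ∀ j ∈ Finset.Icc 1 t, ∀ i, ∫ ω, g (z j i ω) ∂μ = D) (k : ℕ) :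
    μ.real {ω | 2 * (winSize B t k * D) + b * L ≤ ∑ j ∈ window t k, ∑ i, g (z j i ω)}
      ≤ Real.exp (-L) := by
  have h := measureReal_two_mul_integral_le (L := L) (iIndepFun_window hz k hg)
    (fun s => hg.comp (hzm _ (window_subset t k s.1.2) _)) hb0
    (fun s => ae_of_all _ fun ω => h0 _) (fun s => ae_of_all _ fun ω => hb _)
  rw [Finset.sum_congr rfl fun s _ => hD s.1 (window_subset t k s.1.2) s.2,
    Finset.sum_const, Finset.card_univ, card_window_sigma, nsmul_eq_mul] at h
  convert h using 3
  ext ω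
  rw [sum_window_eq_sum_sigma fun j i => g (z j i ω)]

end Events

/-! ### Logarithmic factors -/

section Logarithms

theorem log_six_le_two : Real.log 6 ≤ 2 := by
  rw [Real.log_le_iff_le_exp (by norm_num)]
  have h := Real.exp_one_gt_d9
  have : Real.exp 2 = Real.exp 1 * Real.exp 1 := by rw [← Real.exp_add]; norm_num
  rw [this]
  nlinarith

theorem one_le_log_six : 1 ≤ Real.log 6 := by
  rw [Real.le_log_iff_exp_le (by norm_num)]
  linarith [Real.exp_one_lt_three]

theorem one_add_log_sum_le_mul {x y w : ℝ} (hx : 0 ≤ x) (hy : 0 ≤ y) (hw : 0 ≤ w) :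
    1 + x + y + w ≤ (1 + x) * (1 + y) * (1 + w) := by
  have h1 := mul_nonneg hx hy
  have h2 := mul_nonneg hx hw
  have h3 := mul_nonneg hy hw
  have h4 := mul_nonneg h1 hw
  nlinarith

variable {m t : ℕ} {δ : ℝ}

theorem log_two_div_eq (hm : 1 ≤ m) (ht : 1 ≤ t) (hδ : 0 < δ) :
    Real.log (2 / (δ / (3 * (m : ℝ) ^ 2 * t)))
      = Real.log 6 + 2 * Real.log m + Real.log t + Real.log (1 / δ) := by
  have hm' : (0 : ℝ) < m := by exact_mod_cast hm
  have ht' : (0 : ℝ) < t := by exact_mod_cast ht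
  have e : 2 / (δ / (3 * (m : ℝ) ^ 2 * t)) = 6 * (m : ℝ) ^ 2 * t * (1 / δ) := by
    field_simp; norm_num
  rw [e, Real.log_mul (by positivity) (by positivity), Real.log_mul (by positivity) (by positivity),
    Real.log_mul (by positivity) (by positivity), Real.log_pow]
  norm_num

theorem one_le_log_two_div (hm : 1 ≤ m) (ht : 1 ≤ t) (hδ : 0 < δ) (hδ1 : δ < 1) :
    1 ≤ Real.log (2 / (δ / (3 * (m : ℝ) ^ 2 * t))) := by
  rw [log_two_div_eq hm ht hδ]
  have h1 : 0 ≤ Real.log m := Real.log_natCast_nonneg m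
  have h2 : 0 ≤ Real.log t := Real.log_natCast_nonneg t
  have h3 : 0 ≤ Real.log (1 / δ) := Real.log_nonneg ((one_le_div hδ).2 hδ1.le)
  linarith [one_le_log_six]

theorem log_two_div_le (hm : 1 ≤ m) (ht : 1 ≤ t) (hδ : 0 < δ) (hδ1 : δ < 1) :
    Real.log (2 / (δ / (3 * (m : ℝ) ^ 2 * t)))
      ≤ 2 * ((1 + Real.log m) * (1 + Real.log t) * (1 + Real.log (1 / δ))) := by
  rw [log_two_div_eq hm ht hδ]
  have h1 : 0 ≤ Real.log m := Real.log_natCast_nonneg m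
  have h2 : 0 ≤ Real.log t := Real.log_natCast_nonneg t
  have h3 : 0 ≤ Real.log (1 / δ) := Real.log_nonneg ((one_le_div hδ).2 hδ1.le)
  linarith [one_add_log_sum_le_mul h1 h2 h3, log_six_le_two]

theorem clog_two_le (hδ : 0 < δ) (hδ1 : δ < 1) (m t : ℕ) :
    (Nat.clog 2 m : ℝ)
      ≤ 2 * ((1 + Real.log m) * (1 + Real.log t) * (1 + Real.log (1 / δ))) := by
  have h1 : 0 ≤ Real.log m := Real.log_natCast_nonneg m
  have h2 : 0 ≤ Real.log t := Real.log_natCast_nonneg t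
  have h3 : 0 ≤ Real.log (1 / δ) := Real.log_nonneg ((one_le_div hδ).2 hδ1.le)
  have h4 := one_add_log_sum_le_mul h1 h2 h3
  have h5 : (Nat.clog 2 m : ℝ) ≤ 1 + 2 * Real.log m := by
    rcases Nat.eq_zero_or_pos m with rfl | hm
    · simp
    · have h6 : Nat.clog 2 m ≤ 1 + Nat.log 2 m := by
        apply Nat.clog_le_of_le_pow
        rw [add_comm]
        exact (Nat.lt_pow_succ_log_self one_lt_two m).le
      have h7 : (Nat.log 2 m : ℝ) * Real.log 2 ≤ Real.log m := by
        rw [← Real.log_pow]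
        apply Real.log_le_log (by positivity)
        exact_mod_cast Nat.pow_log_le_self 2 hm.ne'
      have h8 : (Nat.clog 2 m : ℝ) ≤ 1 + Nat.log 2 m := by exact_mod_cast h6
      have h9 : (0 : ℝ) ≤ Nat.log 2 m := by positivity
      nlinarith [Real.log_two_gt_d9]
  linarith

end Logarithms

/-! ### The oracle inequality on the good event -/

section Oracle

variable {X : Type*} [MeasurableSpace X] {t : ℕ} {B : ℕ → ℕ} {P : ℕ → Measure (X × ℝ)}
  [∀ j, IsProbabilityMeasure (P j)] {PX : Measure X} {m : ℕ} {f : Fin m → X → ℝ}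
  {M₀ δ' : ℝ} {data : (j : ℕ) → Fin (B j) → X × ℝ}

theorem le_biasSup (PX : Measure X) (P : ℕ → Measure (X × ℝ)) [∀ j, IsProbabilityMeasure (P j)]
    {t k j : ℕ} (hj : j ∈ window t k) :
    l2norm PX (fun x => regFun (P j) x - regFun (P t) x)
      ≤ ⨆ j : window t k, l2norm PX (fun x => regFun (P j) x - regFun (P t) x) :=
  le_ciSup (f := fun j : window t k => l2norm PX (fun x => regFun (P j) x - regFun (P t) x))
    (Set.finite_range _).bddAbove ⟨j, hj⟩

/-- The localised estimate: the bias `2 d β` and the main part of `ψ̂` both carry the factor `d ≤ 2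
(v a + v b)`, and only the remainder `L/n` is left as `ε²`. -/
theorem abs_winMean_lossDiff_sub_le (hM₀ : 0 < M₀) (ht : 1 ≤ t)
    (hB : ∀ j ∈ Finset.Icc 1 t, 1 ≤ B j)
    (hy : ∀ j ∈ Finset.Icc 1 t, ∀ᵐ w ∂(P j), |w.2| ≤ M₀) (hf : ∀ r, Measurable (f r))
    (hfb : ∀ r x, |f r x| ≤ M₀) (hPX : ∀ j ∈ Finset.Icc 1 t, (P j).map Prod.fst = PX)
    (hL : 1 ≤ Real.log (2 / δ')) {a b : Fin m}
    (hG1 : ∀ k ∈ Finset.Icc 1 t,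
      |winMean (lossDiff data (f a) (f b)) t k - (winSize B t k : ℝ)⁻¹ *
        ∑ j ∈ window t k, B j * ∫ w, (sqLoss (f a) w - sqLoss (f b) w) ∂(P j)|
      ≤ psiHat (lossDiff data (f a) (f b)) (8 * M₀ ^ 2) δ' t k)
    (hG2 : ∀ k ∈ Finset.Icc 1 t,
      ∑ j ∈ window t k, ∑ i, (f a (data j i).1 - f b (data j i).1) ^ 2
        ≤ 2 * (winSize B t k * l2norm PX (fun x => f a x - f b x) ^ 2)
          + 4 * M₀ ^ 2 * Real.log (2 / δ'))
    (hG3 : ∀ j ∈ Finset.Icc 1 t, ∀ i, |(data j i).2| ≤ M₀)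
    {s k : ℕ} (hs : IsSelectedWindow (lossDiff data (f a) (f b)) (8 * M₀ ^ 2) δ' t s)
    (hk : k ∈ Finset.Icc 1 t) {ε : ℝ}
    (hε : ε = (⨆ j : window t k, l2norm PX (fun x => regFun (P j) x - regFun (P t) x))
      + √(Real.log (2 / δ') / winSize B t k)) :
    |winMean (lossDiff data (f a) (f b)) t s
        - (l2norm PX (fun x => f a x - regFun (P t) x) ^ 2
          - l2norm PX (fun x => f b x - regFun (P t) x) ^ 2)|
      ≤ (12 + 72 * M₀ + 183 * M₀ ^ 2) *
        ((l2norm PX (fun x => f a x - regFun (P t) x)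
          + l2norm PX (fun x => f b x - regFun (P t) x)) * ε + ε ^ 2) := by
  have htt : t ∈ Finset.Icc 1 t := Finset.mem_Icc.2 ⟨ht, le_rfl⟩
  have : IsFiniteMeasure PX := by rw [← hPX t htt]; infer_instance
  have hfL : ∀ r, MemLp (f r) 2 PX := fun r =>
    MemLp.of_bound (hf r).aestronglyMeasurable M₀ (ae_of_all _ (hfb r))
  have hd := l2norm_sub_le (hfL a) (hfL b) (memLp_regFun (hPX t htt) (hy t htt))
  rw [← integral_sqLoss_sub_eq_l2norm (hPX t htt) (hy t htt) (hf a) (hf b) (hfb a) (hfb b)]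
  set Δ := ∫ w, (sqLoss (f a) w - sqLoss (f b) w) ∂(P t)
  set v := l2norm PX (fun x => f a x - regFun (P t) x)
    + l2norm PX (fun x => f b x - regFun (P t) x) with hv
  have hv0 : 0 ≤ v := add_nonneg (l2norm_nonneg _ _) (l2norm_nonneg _ _)
  set d := l2norm PX (fun x => f a x - f b x)
  have hd0 : 0 ≤ d := l2norm_nonneg _ _
  set β : ℕ → ℝ := fun k =>
    ⨆ j : window t k, l2norm PX (fun x => regFun (P j) x - regFun (P t) x) with hβ
  have hβ0 : ∀ k, 0 ≤ β k := fun k => Real.iSup_nonneg fun _ => l2norm_nonneg _ _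
  have hψ : ∀ k ∈ Finset.Icc 1 t,
      0 ≤ psiHat (lossDiff data (f a) (f b)) (8 * M₀ ^ 2) δ' t k := fun k hk =>
    psiHat_nonneg (by positivity) (by linarith) (one_le_winSize hB hk)
  have hmain := hs.abs_winMean_sub_le (Δ := Δ) (b := fun k => 2 * (d * β k))
    (fun k _ => mul_nonneg zero_le_two (mul_nonneg hd0 (hβ0 k)))
    (fun i _ k _ hik => by
      have : β i ≤ β k :=
        Real.iSup_le (fun j => le_biasSup PX P (window_mono hik j.2)) (hβ0 k)
      gcongr)
    hψ
    (fun k hk => by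
      refine (abs_sub_le _ ((winSize B t k : ℝ)⁻¹ * ∑ j ∈ window t k,
        B j * ∫ w, (sqLoss (f a) w - sqLoss (f b) w) ∂(P j)) _).trans
        (add_le_add (hG1 k hk) ?_)
      refine abs_inv_winSize_mul_sum_sub_le (one_le_winSize hB hk) fun j hj => ?_
      have hj' := window_subset t k hj
      refine (abs_integral_sqLoss_sub_sub_le (hPX t htt) (hy t htt) (hPX j hj') (hy j hj')
        (hf a) (hf b) (hfb a) (hfb b)).trans ?_
      have := le_biasSup PX P hj
      gcongr) hk
  have hψk := psiHat_le (u := lossDiff data (f a) (f b)) hM₀ hd0 hL (one_le_winSize hB hk) (by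
    calc ∑ j ∈ window t k, ∑ i, lossDiff data (f a) (f b) j i ^ 2
        ≤ ∑ j ∈ window t k, ∑ i,
            16 * M₀ ^ 2 * (f a (data j i).1 - f b (data j i).1) ^ 2 := by
          refine Finset.sum_le_sum fun j hj => Finset.sum_le_sum fun i _ => ?_
          have h1 := abs_le.1 (hG3 j (window_subset t k hj) i)
          have h2 := abs_le.1 (hfb a (data j i).1)
          have h3 := abs_le.1 (hfb b (data j i).1)
          have e : lossDiff data (f a) (f b) j i ^ 2
              = (f a (data j i).1 + f b (data j i).1 - 2 * (data j i).2) ^ 2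
                * (f a (data j i).1 - f b (data j i).1) ^ 2 := by
            simp only [lossDiff, sqLoss]; ring
          rw [e]
          gcongr
          have : (16 * M₀ ^ 2 : ℝ) = (4 * M₀) ^ 2 := by ring
          rw [this]
          exact sq_le_sq' (by linarith) (by linarith)
      _ = 16 * M₀ ^ 2 * ∑ j ∈ window t k, ∑ i,
            (f a (data j i).1 - f b (data j i).1) ^ 2 := by
          simp only [Finset.mul_sum]
      _ ≤ _ := by
          gcongr
          exact hG2 k hk)
  set σ := √(Real.log (2 / δ') / winSize B t k) with hσ
  have hσ0 : 0 ≤ σ := Real.sqrt_nonneg _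
  have hσ2 : Real.log (2 / δ') / winSize B t k = σ ^ 2 :=
    (Real.sq_sqrt (div_nonneg (by linarith) (Nat.cast_nonneg _))).symm
  rw [hσ2] at hψk
  have hβε : β k ≤ ε := by rw [hε]; linarith
  have hσε : σ ≤ ε := by rw [hε]; linarith [hβ0 k]
  have hε0 : 0 ≤ ε := hσ0.trans hσε
  -- Here `12 = 3·2·2`, `72 = 3·12·2` and `183 = 3·61`.
  calc _ ≤ 3 * (2 * (d * β k)) + 3 * (12 * M₀ * d * σ + 61 * M₀ ^ 2 * σ ^ 2) := by
        linarith
    _ ≤ 3 * (2 * (2 * v * ε)) + 3 * (12 * M₀ * (2 * v) * ε + 61 * M₀ ^ 2 * ε ^ 2) := by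
        have := hβ0 k
        gcongr
    _ ≤ _ := by
        have h1 : 0 ≤ v * ε := by positivity
        have h2 : 0 ≤ M₀ ^ 2 * (v * ε) := by positivity
        have h3 : 0 ≤ (12 + 72 * M₀) * ε ^ 2 := by positivity
        nlinarith

/-- One factor `2Λ` bounds the number of rounds; the other comes from `√L ≤ L ≤ 2Λ` inside `ε`.
Together they give `4 Λ²`. -/
theorem l2norm_sub_iInf_le (hM₀ : 0 < M₀) (ht : 1 ≤ t)
    (hB : ∀ j ∈ Finset.Icc 1 t, 1 ≤ B j)
    (hy : ∀ j ∈ Finset.Icc 1 t, ∀ᵐ w ∂(P j), |w.2| ≤ M₀) (hf : ∀ r, Measurable (f r))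
    (hfb : ∀ r x, |f r x| ≤ M₀) (hPX : ∀ j ∈ Finset.Icc 1 t, (P j).map Prod.fst = PX)
    (hL : 1 ≤ Real.log (2 / δ'))
    (hG1 : ∀ a b, ∀ k ∈ Finset.Icc 1 t,
      |winMean (lossDiff data (f a) (f b)) t k - (winSize B t k : ℝ)⁻¹ *
        ∑ j ∈ window t k, B j * ∫ w, (sqLoss (f a) w - sqLoss (f b) w) ∂(P j)|
      ≤ psiHat (lossDiff data (f a) (f b)) (8 * M₀ ^ 2) δ' t k)
    (hG2 : ∀ a b, ∀ k ∈ Finset.Icc 1 t,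
      ∑ j ∈ window t k, ∑ i, (f a (data j i).1 - f b (data j i).1) ^ 2
        ≤ 2 * (winSize B t k * l2norm PX (fun x => f a x - f b x) ^ 2)
          + 4 * M₀ ^ 2 * Real.log (2 / δ'))
    (hG3 : ∀ j ∈ Finset.Icc 1 t, ∀ i, |(data j i).2| ≤ M₀)
    {r : Fin m} (hr : IsTournamentOutput data (8 * M₀ ^ 2) δ' t f r) {Λ : ℝ}
    (hLΛ : Real.log (2 / δ') ≤ 2 * Λ) (hm : (Nat.clog 2 m : ℝ) ≤ 2 * Λ) :
    l2norm PX (fun x => f r x - regFun (P t) x)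
        - ⨅ r' : Fin m, l2norm PX (fun x => f r' x - regFun (P t) x)
      ≤ 4 * (13 + 72 * M₀ + 183 * M₀ ^ 2) * Λ ^ 2 *
        ⨅ k : Finset.Icc 1 t,
          ((⨆ j : window t k, l2norm PX (fun x => regFun (P j) x - regFun (P t) x))
            + 1 / √(winSize B t k)) := by
  have : Nonempty (Fin m) := ⟨r⟩
  have : Nonempty (Finset.Icc 1 t) := ⟨⟨t, Finset.mem_Icc.2 ⟨ht, le_rfl⟩⟩⟩
  obtain ⟨⟨k, hk⟩, hkmin⟩ := exists_eq_ciInf_of_finite (f := fun k : Finset.Icc 1 t =>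
    ((⨆ j : window t k, l2norm PX (fun x => regFun (P j) x - regFun (P t) x))
      + 1 / √(winSize B t k)))
  obtain ⟨r', hr'⟩ := exists_eq_ciInf_of_finite
    (f := fun r' : Fin m => l2norm PX (fun x => f r' x - regFun (P t) x))
  rw [← hkmin, ← hr']
  dsimp only
  set β := ⨆ j : window t k, l2norm PX (fun x => regFun (P j) x - regFun (P t) x) with hβ
  have hβ0 : 0 ≤ β := Real.iSup_nonneg fun _ => l2norm_nonneg _ _
  have hn : (0 : ℝ) < winSize B t k := by exact_mod_cast one_le_winSize hB hk
  set ε := β + √(Real.log (2 / δ') / winSize B t k) with hε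
  have hε0 : 0 < ε := by
    have : 0 < √(Real.log (2 / δ') / winSize B t k) := Real.sqrt_pos.2 (by positivity)
    positivity
  have hC : 0 ≤ 12 + 72 * M₀ + 183 * M₀ ^ 2 := by positivity
  have hround : ∀ a b c, IsComparisonOutput data (8 * M₀ ^ 2) δ' t f a b c →
      l2norm PX (fun x => f c x - regFun (P t) x)
          ≤ l2norm PX (fun x => f a x - regFun (P t) x) + (12 + 72 * M₀ + 183 * M₀ ^ 2 + 1) * ε ∧
      l2norm PX (fun x => f c x - regFun (P t) x)
          ≤ l2norm PX (fun x => f b x - regFun (P t) x)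
            + (12 + 72 * M₀ + 183 * M₀ ^ 2 + 1) * ε := fun a b c h =>
    h.le_add (v := fun r => l2norm PX (fun x => f r x - regFun (P t) x))
      (fun _ => l2norm_nonneg _ _) hC hε0 fun s hs =>
      abs_winMean_lossDiff_sub_le hM₀ ht hB hy hf hfb hPX hL (hG1 a b) (hG2 a b) hG3 hs hk hε
  obtain ⟨y, hy1, hy2⟩ := IsRounds.exists_le
    (v := fun r => l2norm PX (fun x => f r x - regFun (P t) x)) (by positivity) hround hr r'
    (List.mem_finRange r')
  rw [List.mem_singleton] at hy1
  subst hy1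
  have hsqrtL : √(Real.log (2 / δ')) ≤ 2 * Λ := by
    refine le_trans ?_ hLΛ
    apply Real.sqrt_le_iff.2
    exact ⟨by linarith, by nlinarith⟩
  have hεle : ε ≤ 2 * Λ * (β + 1 / √(winSize B t k)) := by
    rw [hε, Real.sqrt_div (by linarith), mul_add, mul_one_div]
    have : β ≤ 2 * Λ * β := le_mul_of_one_le_left hβ0 (hL.trans hLΛ)
    gcongr
  have hclog : (0 : ℝ) ≤ Nat.clog 2 m := Nat.cast_nonneg _
  have hΛ : 0 ≤ 2 * Λ := hclog.trans hm
  calc _ ≤ (Nat.clog 2 m : ℝ) * ((12 + 72 * M₀ + 183 * M₀ ^ 2 + 1) * ε) := by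
        linarith
    _ ≤ 2 * Λ * ((12 + 72 * M₀ + 183 * M₀ ^ 2 + 1)
          * (2 * Λ * (β + 1 / √(winSize B t k)))) := by gcongr
    _ = _ := by ring

end Oracle

theorem exists_isTournamentOutput {X : Type*} {B : ℕ → ℕ} {t m : ℕ}
    (data : (j : ℕ) → Fin (B j) → X × ℝ) (M δ' : ℝ) (ht : 1 ≤ t) (hm : 1 ≤ m) (f : Fin m → X → ℝ) : ∃ r, IsTournamentOutput data M δ' t f r := by
  refine exists_isRounds_singleton (fun a b => ?_) _ _ ?_ ?_
  · obtain ⟨k, hk⟩ := exists_isSelectedWindow (lossDiff data (f a) (f b)) M δ' ht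
    exact ⟨_, k, hk, rfl⟩
  · exact List.ne_nil_of_length_pos (by rw [List.length_finRange]; omega)
  · rw [List.length_finRange]
    exact Nat.le_pow_clog one_lt_two m

/-! ### The union bound -/

section Probability

variable {X : Type*} [MeasurableSpace X] {Ω : Type*} [MeasurableSpace Ω] {μ : Measure Ω}
  [IsProbabilityMeasure μ] {t : ℕ} {B : ℕ → ℕ} {P : ℕ → Measure (X × ℝ)} {PX : Measure X}
  {z : (j : ℕ) → Fin (B j) → Ω → X × ℝ} {m : ℕ} {f : Fin m → X → ℝ} {M₀ δ' : ℝ}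

/-- Subadditivity over `S ∪ T` suffices, so neither set has to be measurable. -/
theorem ofReal_one_sub_le_of_compl_subset {S T : Set Ω} {δ : ℝ} (hδ : 0 ≤ δ)
    (hT : μ.real T ≤ δ) (hST : Tᶜ ⊆ S) : ENNReal.ofReal (1 - δ) ≤ μ S := by
  rw [ENNReal.ofReal_sub _ hδ, ENNReal.ofReal_one, tsub_le_iff_right]
  calc (1 : ENNReal) = μ Set.univ := measure_univ.symm
    _ ≤ μ (S ∪ T) := measure_mono fun ω _ => by
        by_cases h : ω ∈ T
        · exact Or.inr h
        · exact Or.inl (hST h)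
    _ ≤ μ S + μ T := measure_union_le _ _
    _ ≤ μ S + ENNReal.ofReal δ := by
        gcongr
        exact (ENNReal.le_ofReal_iff_toReal_le (measure_ne_top _ _) hδ).2 hT

/-- Outside an event of small probability, all the deviation bounds used in the analysis of the
tournament hold simultaneously. -/
theorem exists_deviation_event (hM₀ : 0 < M₀) (hB : ∀ j ∈ Finset.Icc 1 t, 1 ≤ B j)
    (hz : ∀ j ∈ Finset.Icc 1 t, ∀ i : Fin (B j), Measurable (z j i) ∧ μ.map (z j i) = P j)
    (hind : iIndepFun (fun (s : (j : Finset.Icc 1 t) × Fin (B j)) => z s.1 s.2) μ)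
    (hy : ∀ j ∈ Finset.Icc 1 t, ∀ᵐ w ∂(P j), |w.2| ≤ M₀) (hf : ∀ r, Measurable (f r))
    (hfb : ∀ r x, |f r x| ≤ M₀) (hPX : ∀ j ∈ Finset.Icc 1 t, (P j).map Prod.fst = PX)
    (hL : 1 ≤ Real.log (2 / δ')) :
    ∃ T : Set Ω, μ.real T ≤ (m : ℝ) ^ 2 * t * (4 * Real.exp (-Real.log (2 / δ'))) ∧
      ∀ ω ∉ T,
        (∀ a b, ∀ k ∈ Finset.Icc 1 t,
          |winMean (lossDiff (fun j i => z j i ω) (f a) (f b)) t k - (winSize B t k : ℝ)⁻¹ *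
            ∑ j ∈ window t k, B j * ∫ w, (sqLoss (f a) w - sqLoss (f b) w) ∂(P j)|
          ≤ psiHat (lossDiff (fun j i => z j i ω) (f a) (f b)) (8 * M₀ ^ 2) δ' t k) ∧
        (∀ a b, ∀ k ∈ Finset.Icc 1 t,
          ∑ j ∈ window t k, ∑ i, (f a (z j i ω).1 - f b (z j i ω).1) ^ 2
            ≤ 2 * (winSize B t k * l2norm PX (fun x => f a x - f b x) ^ 2)
              + 4 * M₀ ^ 2 * Real.log (2 / δ')) ∧
        ∀ j ∈ Finset.Icc 1 t, ∀ i, |(z j i ω).2| ≤ M₀ := by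
  have hzm : ∀ j ∈ Finset.Icc 1 t, ∀ i, Measurable (z j i) := fun j hj i => (hz j hj i).1
  have hyz : ∀ j ∈ Finset.Icc 1 t, ∀ i, ∀ᵐ ω ∂μ, |(z j i ω).2| ≤ M₀ := fun j hj i =>
    ae_of_ae_map (hzm j hj i).aemeasurable (by rw [(hz j hj i).2]; exact hy j hj)
  have hgm : ∀ a b, Measurable fun w : X × ℝ => sqLoss (f a) w - sqLoss (f b) w := fun a b => by
    have h : ∀ r, Measurable fun w : X × ℝ => f r w.1 := fun r => (hf r).comp measurable_fst
    exact (((h a).sub measurable_snd).pow_const 2).sub (((h b).sub measurable_snd).pow_const 2)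
  have hhm : ∀ a b, Measurable fun w : X × ℝ => (f a w.1 - f b w.1) ^ 2 := fun a b =>
    (((hf a).comp measurable_fst).sub ((hf b).comp measurable_fst)).pow_const 2
  set T1 : Fin m × Fin m × Finset.Icc 1 t → Set Ω := fun p =>
    {ω | psiHat (lossDiff (fun j i => z j i ω) (f p.1) (f p.2.1)) (8 * M₀ ^ 2) δ' t p.2.2
      < |winMean (lossDiff (fun j i => z j i ω) (f p.1) (f p.2.1)) t p.2.2
        - (winSize B t p.2.2 : ℝ)⁻¹ * ∑ j ∈ window t p.2.2,
          B j * ∫ w, (sqLoss (f p.1) w - sqLoss (f p.2.1) w) ∂(P j)|} with hT1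
  set T2 : Fin m × Fin m × Finset.Icc 1 t → Set Ω := fun p =>
    {ω | 2 * (winSize B t p.2.2 * l2norm PX (fun x => f p.1 x - f p.2.1 x) ^ 2)
        + 4 * M₀ ^ 2 * Real.log (2 / δ')
      ≤ ∑ j ∈ window t p.2.2, ∑ i, (f p.1 (z j i ω).1 - f p.2.1 (z j i ω).1) ^ 2} with hT2
  set N : Set Ω := {ω | ¬ ∀ s : (j : Finset.Icc 1 t) × Fin (B j), |(z s.1 s.2 ω).2| ≤ M₀} with hN
  have hN0 : μ.real N = 0 := by
    have : ∀ᵐ ω ∂μ, ∀ s : (j : Finset.Icc 1 t) × Fin (B j), |(z s.1 s.2 ω).2| ≤ M₀ :=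
      ae_all_iff.2 fun s => hyz s.1 s.1.2 s.2
    rw [measureReal_def, ae_iff.1 this]
    rfl
  have h1 : ∀ p, μ.real (T1 p) ≤ 3 * Real.exp (-Real.log (2 / δ')) := by
    rintro ⟨a, b, k, hk⟩
    have h := measureReal_psiHat_lt_le (K := 4 * M₀ ^ 2) hind hzm (hgm a b) (by positivity)
      (by linarith : 0 < Real.log (2 / δ'))
      (fun j hj i => by
        filter_upwards [hyz j hj i] with ω hω
        have e : ∀ r, 0 ≤ sqLoss (f r) (z j i ω) ∧ sqLoss (f r) (z j i ω) ≤ 4 * M₀ ^ 2 := by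
          intro r
          have h1 := abs_le.1 hω
          have h2 := abs_le.1 (hfb r (z j i ω).1)
          refine ⟨sq_nonneg _, ?_⟩
          have : (4 * M₀ ^ 2 : ℝ) = (2 * M₀) ^ 2 := by ring
          rw [this]
          exact sq_le_sq' (by linarith) (by linarith)
        rw [abs_le]
        constructor <;> linarith [(e a).1, (e a).2, (e b).1, (e b).2])
      (D := fun j => ∫ w, (sqLoss (f a) w - sqLoss (f b) w) ∂(P j))
      (fun j hj i => by
        rw [← (hz j hj i).2, integral_map (hzm j hj i).aemeasurable
          (hgm a b).aestronglyMeasurable])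
      (one_le_winSize hB hk)
    rw [show 2 * (4 * M₀ ^ 2) = 8 * M₀ ^ 2 by ring] at h
    exact h
  have h2 : ∀ p, μ.real (T2 p) ≤ Real.exp (-Real.log (2 / δ')) := by
    rintro ⟨a, b, k, hk⟩
    refine measureReal_sum_sq_ge_le (b := 4 * M₀ ^ 2) hind hzm (hhm a b) (by positivity)
      (fun w => sq_nonneg _) (fun w => ?_) (fun j hj i => ?_) k
    · have h2 := abs_le.1 (hfb a w.1)
      have h3 := abs_le.1 (hfb b w.1)
      have : (4 * M₀ ^ 2 : ℝ) = (2 * M₀) ^ 2 := by ring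
      rw [this]
      exact sq_le_sq' (by linarith) (by linarith)
    · rw [l2norm_sq, ← hPX j hj, ← (hz j hj i).2, Measure.map_map measurable_fst (hzm j hj i),
        integral_map (f := fun x => (f a x - f b x) * (f a x - f b x))
          (measurable_fst.comp (hzm j hj i)).aemeasurable
          (((hf a).sub (hf b)).mul ((hf a).sub (hf b))).aestronglyMeasurable]
      refine integral_congr_ae (ae_of_all _ fun ω => ?_)
      simp only [Function.comp_apply]
      ring
  refine ⟨(⋃ p, T1 p ∪ T2 p) ∪ N, ?_, fun ω hω => ?_⟩
  · calc μ.real ((⋃ p, T1 p ∪ T2 p) ∪ N) ≤ ∑ p, μ.real (T1 p ∪ T2 p) + μ.real N :=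
          (measureReal_union_le _ _).trans (by gcongr; exact measureReal_iUnion_fintype_le _)
      -- Three failure terms from empirical Bernstein and one from the second moment, for each of
      -- `m² t` triples.
      _ ≤ ∑ _p : Fin m × Fin m × Finset.Icc 1 t, 4 * Real.exp (-Real.log (2 / δ')) := by
          rw [hN0, add_zero]
          refine Finset.sum_le_sum fun p _ => (measureReal_union_le _ _).trans ?_
          linarith [h1 p, h2 p]
      _ = _ := by
          simp only [Finset.sum_const, Finset.card_univ, Fintype.card_prod, Fintype.card_fin,
            Fintype.card_coe, Nat.card_Icc, nsmul_eq_mul]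
          push_cast [Nat.add_sub_cancel]
          ring
  · simp only [Set.mem_union, Set.mem_iUnion, not_or, not_exists] at hω
    obtain ⟨hω, hω3⟩ := hω
    refine ⟨fun a b k hk => ?_, fun a b k hk => ?_, fun j hj i => ?_⟩
    · exact not_lt.1 (hω (a, b, ⟨k, hk⟩)).1
    · exact (not_le.1 (hω (a, b, ⟨k, hk⟩)).2).le
    · exact not_not.1 hω3 ⟨⟨j, hj⟩, i⟩

end Probability

end RollingWindow

theorem mainTheorem4 :
    ∃ p : ℕ, ∀ M₀ : ℝ, 0 < M₀ → ∃ C : ℝ, 0 < C ∧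
      ∀ (X : Type*) [MeasurableSpace X] (Ω : Type*) [MeasurableSpace Ω]
        (μ : Measure Ω) [IsProbabilityMeasure μ]
        -- current time, batch sizes, data distributions, covariate distribution
        (t : ℕ) (B : ℕ → ℕ) (P : ℕ → Measure (X × ℝ)) [∀ j, IsProbabilityMeasure (P j)]
        (PX : Measure X)
        -- samples
        (z : (j : ℕ) → Fin (B j) → Ω → X × ℝ)
        -- candidate models
        (m : ℕ) (f : Fin m → X → ℝ) (δ : ℝ),
        1 ≤ t → (∀ j ∈ Finset.Icc 1 t, 1 ≤ B j) →
        -- the samples are independent, and those of period `j` are drawn from `P j`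
        (∀ j ∈ Finset.Icc 1 t, ∀ i : Fin (B j), Measurable (z j i) ∧ μ.map (z j i) = P j) →
        iIndepFun (fun (s : (j : Finset.Icc 1 t) × Fin (B j)) => z s.1 s.2) μ →
        -- bounded response, bounded models, no covariate shift
        (∀ j ∈ Finset.Icc 1 t, ∀ᵐ w ∂(P j), |w.2| ≤ M₀) →
        1 ≤ m → (∀ r, Measurable (f r)) → (∀ r x, |f r x| ≤ M₀) →
        (∀ j ∈ Finset.Icc 1 t, (P j).map Prod.fst = PX) →
        0 < δ → δ < 1 →
        ENNReal.ofReal (1 - δ) ≤ μ {ω |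
          (∃ r, RollingWindow.IsTournamentOutput (fun j i => z j i ω) (8 * M₀ ^ 2)
            (δ / (3 * (m : ℝ) ^ 2 * t)) t f r) ∧
          ∀ r, RollingWindow.IsTournamentOutput (fun j i => z j i ω) (8 * M₀ ^ 2)
              (δ / (3 * (m : ℝ) ^ 2 * t)) t f r →
            RollingWindow.l2norm PX (fun x => f r x - RollingWindow.regFun (P t) x)
                - ⨅ r' : Fin m,
                    RollingWindow.l2norm PX (fun x => f r' x - RollingWindow.regFun (P t) x)
              ≤ C * ((1 + Real.log m) * (1 + Real.log t) * (1 + Real.log (1 / δ))) ^ p *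
                ⨅ k : Finset.Icc 1 t,
                  ((⨆ j : RollingWindow.window t k,
                      RollingWindow.l2norm PX (fun x =>
                        RollingWindow.regFun (P j) x - RollingWindow.regFun (P t) x))
                    + 1 / Real.sqrt (RollingWindow.winSize B t k))} := by
  refine ⟨2, fun M₀ hM₀ => ⟨4 * (13 + 72 * M₀ + 183 * M₀ ^ 2), by positivity, ?_⟩⟩
  intro X _ Ω _ μ _ t B P _ PX z m f δ ht hB hz hind hy hm hf hfb hPX hδ hδ1
  have hL := RollingWindow.one_le_log_two_div hm ht hδ hδ1
  have hm0 : (0 : ℝ) < m := by exact_mod_cast hm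
  have ht0 : (0 : ℝ) < t := by exact_mod_cast ht
  obtain ⟨T, hT, hgood⟩ := RollingWindow.exists_deviation_event hM₀ hB hz hind hy hf hfb hPX hL
  refine RollingWindow.ofReal_one_sub_le_of_compl_subset hδ.le (hT.trans ?_) fun ω hω => ?_
  -- As `exp (-L) = δ'/2`, the total failure probability is at most `4 m² t · δ'/2 = 2δ/3`.
  · rw [Real.exp_neg, Real.exp_log (by positivity)]
    have e : (m : ℝ) ^ 2 * t * (4 * (2 / (δ / (3 * (m : ℝ) ^ 2 * t)))⁻¹) = 2 / 3 * δ := by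
      field_simp; norm_num
    rw [e]
    linarith
  · obtain ⟨h1, h2, h3⟩ := hgood ω hω
    exact ⟨RollingWindow.exists_isTournamentOutput _ _ _ ht hm f, fun r hr =>
      RollingWindow.l2norm_sub_iInf_le hM₀ ht hB hy hf hfb hPX hL h1 h2 h3 hr
        (RollingWindow.log_two_div_le hm ht hδ hδ1) (RollingWindow.clog_two_le hδ hδ1 m t)⟩
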